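/- Let $L_2(\mathbb R_+)$ be the space of complex-valued square-integrable functions on $(0,\infty)$ with norm $\|\cdot\|$, and let $$(\mathcal H_+f)(x)=\sqrt{\tfrac{2}{\pi}}\int_0^\infty[\cos(xt)+\sin(xt)]\,f(t)\,dt,\qquad x>0,$$ be the half-Hartley transform. Let $C^{(2)}_c(\mathbb R_+)$ be the dense subspace of $L_2(\mathbb R_+)$ of twice continuously differentiable functions with compact support in $(0,\infty)$. For $f\in C^{(2)}_c(\mathbb R_+)$ both $f$ and $\mathcal H_+f$ are absolutely integrable on $(0,\infty)$, so the iterated half-Hartley transform $\mathcal H_+^2f=\mathcal H_+(\mathcal H_+f)$ is defined by absolutely convergent integrals. It extends uniquely from $C^{(2)}_c(\mathbb R_+)$ to a bounded operator $\mathcal H_+^2:L_2(\mathbb R_+)\to L_2(\mathbb R_+)$; this operator is the square of a bounded extension of $\mathcal H_+$ to $L_2(\mathbb R_+)$, and it is invertible with bounded inverse. For every $f\in L_2(\mathbb R_+)$ the following reciprocal formulas hold for almost every $x>0$: $$(\mathcal H_+^2f)(x)=2f(x)+\frac{2}{\pi}\int_0^\infty\frac{f(t)}{x+t}\,dt,$$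 $$f(x)=\frac12(\mathcal H_+^2f)(x)-\frac1{\pi^2}\int_0^\infty\frac{\sqrt{xt}\,[\log x-\log t]}{x^2-t^2}\,(\mathcal H_+^2f)(t)\,dt,$$ where both integrals converge absolutely for every $x>0$. Moreover, for every $f\in L_2(\mathbb R_+)$, $$\|f\|\le\|\mathcal H_+^2f\|\le 8\,\|f\|.$$ -/

import Mathlib

open MeasureTheory Set

/-- Lebesgue measure on the half-line `(0, ∞)`. -/
noncomputable abbrev halfLine : Measure ℝ := volume.restrict (Ioi (0 : ℝ))

/-- The complex Hilbert space `L₂(ℝ₊)`. -/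
abbrev L2HalfLine : Type := Lp ℂ 2 halfLine

/-- The half-Hartley transform
`(H₊ f)(x) = √(2/π) ∫₀^∞ [cos(xt) + sin(xt)] f(t) dt`, as a Lebesgue integral. -/
noncomputable def halfHartley (f : ℝ → ℂ) (x : ℝ) : ℂ :=
  (Real.sqrt (2 / Real.pi) : ℂ) *
    ∫ t in Ioi (0 : ℝ), ((Real.cos (x * t) + Real.sin (x * t) : ℝ) : ℂ) * f t

/-- The class `C_c^(2)(ℝ₊)`: twice continuously differentiable functions with compact support
contained in the open half-line `(0, ∞)`, extended by zero to `ℝ`. -/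
structure IsTestFunction (f : ℝ → ℂ) : Prop where
  contDiff : ContDiff ℝ 2 f
  hasCompactSupport : HasCompactSupport f
  tsupport_subset : tsupport f ⊆ Ioi (0 : ℝ)

/-- The bounded operator `T` on `L₂(ℝ₊)` extends the transform `K`, given on test functions. -/
def ExtendsTransform (K : (ℝ → ℂ) → ℝ → ℂ) (T : L2HalfLine →L[ℂ] L2HalfLine) : Prop :=
  ∀ f : ℝ → ℂ, IsTestFunction f →
    ∃ hf : MemLp f 2 halfLine, (T (hf.toLp f) : ℝ → ℂ) =ᵐ[halfLine] K f

/-- The kernel `√(xt) (log x - log t) / (x² - t²)`; its value on the diagonal `x = t` (a null set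
for each `x`) is irrelevant. -/
noncomputable def logKernel (x t : ℝ) : ℝ :=
  Real.sqrt (x * t) * (Real.log x - Real.log t) / (x ^ 2 - t ^ 2)

open Filter Topology
open scoped ENNReal ContDiff InnerProductSpace

/-! Let `S`, `P`, `Q` be the operators with kernels `1 / (x + t)`, `√(xt) / (x² + t²)` and `(x + t)
/ (√2 (x² + t²))`. On test functions the iterated transform is `T = 2 + (2/π) S`: damp the outer
integral by `exp (-ε y)`, move the transform across by Fubini, and let `ε → 0`. The product `cas(xy)
cas(ty)` equals `cos((x - t)y) + sin((x + t)y)`; the first term yields a Poisson kernel, hence `2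
f`, and the second yields `S`.

The kernels are homogeneous of degree `-1`, so a Mellin transform turns them into multipliers: `S`
into `π / cosh(πs)` and `P` into `(π/2) / cosh(πs/2)`. Thus `T` becomes `4 cosh²(πs/2) / cosh(πs)`,
whose reciprocal is `1/2 - 1 / (4 cosh²(πs/2))`, so `T⁻¹ = 1/2 - P²/π²`. The proof uses no Mellin
theory: explicit integrals give `S P = P S = π (Q - P)` and `Q P = P Q = (π/2) S`, from which `T T⁻¹
= T⁻¹ T = 1` is algebra. The kernel of `P²` is `logKernel`.

The Schur test with weight `t^(-1/2)` gives `‖S‖ ≤ π` and `‖P‖ ≤ π/2`, hence `‖T‖ ≤ 4` and `‖T⁻¹‖ ≤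
3/4`. Finally `‖H f‖² = ⟪f, T f⟫` on test functions bounds the transform `H` itself; density extends
it, and its symmetry gives `T = H²`. -/

/-! ### Elementary rational integrals on the half-line -/

theorem quartic_factor (v : ℝ) :
    0 < v ^ 2 + √2 * v + 1 ∧ 0 < v ^ 2 - √2 * v + 1 ∧
      1 + v ^ 4 = (v ^ 2 + √2 * v + 1) * (v ^ 2 - √2 * v + 1) := by
  have h2 : √2 ^ 2 = 2 := Real.sq_sqrt (by norm_num)
  refine ⟨?_, ?_, ?_⟩
  · nlinarith [sq_nonneg (v + √2 / 2)]
  · nlinarith [sq_nonneg (v - √2 / 2)]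
  · linear_combination (v ^ 2) * h2

/-- Partial fractions over the two quadratic factors split into an odd part (logarithms) and an even
part (arctangents). Suitable combinations of this derivative and the next give `1 / (1 + v⁴)` and
`v² / (1 + v⁴)`. -/
theorem hasDerivAt_quartic_log (v : ℝ) :
    HasDerivAt (fun v : ℝ => Real.log (v ^ 2 + √2 * v + 1) - Real.log (v ^ 2 - √2 * v + 1))
      (2 * √2 * (1 - v ^ 2) / (1 + v ^ 4)) v := by
  obtain ⟨hp, hm, hq⟩ := quartic_factor v
  have d1 : HasDerivAt (fun v : ℝ => v ^ 2 + √2 * v + 1) (2 * v + √2) v := by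
    simpa using (((hasDerivAt_id v).pow 2).add ((hasDerivAt_id v).const_mul √2)).add_const 1
  have d2 : HasDerivAt (fun v : ℝ => v ^ 2 - √2 * v + 1) (2 * v - √2) v := by
    simpa using (((hasDerivAt_id v).pow 2).sub ((hasDerivAt_id v).const_mul √2)).add_const 1
  refine ((d1.log hp.ne').sub (d2.log hm.ne')).congr_deriv ?_
  have hp' := hp.ne'
  have hm' := hm.ne'
  rw [hq, div_sub_div _ _ hp' hm']
  congr 1
  ring

theorem hasDerivAt_quartic_arctan (v : ℝ) :
    HasDerivAt (fun v : ℝ => Real.arctan (√2 * v + 1) + Real.arctan (√2 * v - 1))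
      (√2 * (1 + v ^ 2) / (1 + v ^ 4)) v := by
  obtain ⟨hp, hm, hq⟩ := quartic_factor v
  have h2 : √2 ^ 2 = 2 := Real.sq_sqrt (by norm_num)
  have d1 : HasDerivAt (fun v : ℝ => √2 * v + 1) √2 v := by
    simpa using ((hasDerivAt_id v).const_mul √2).add_const 1
  have d2 : HasDerivAt (fun v : ℝ => √2 * v - 1) √2 v := by
    simpa using ((hasDerivAt_id v).const_mul √2).sub_const 1
  refine (d1.arctan.add d2.arctan).congr_deriv ?_
  have e1 : 1 + (√2 * v + 1) ^ 2 = 2 * (v ^ 2 + √2 * v + 1) := by linear_combination (v ^ 2) * h2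
  have e2 : 1 + (√2 * v - 1) ^ 2 = 2 * (v ^ 2 - √2 * v + 1) := by linear_combination (v ^ 2) * h2
  have hp' := hp.ne'
  have hm' := hm.ne'
  rw [hq, e1, e2, div_mul_eq_mul_div, div_mul_eq_mul_div,
    div_add_div _ _ (mul_ne_zero two_ne_zero hp') (mul_ne_zero two_ne_zero hm'),
    div_eq_div_iff (by positivity) (by positivity)]
  ring

theorem tendsto_quartic_log :
    Tendsto (fun v : ℝ => Real.log (v ^ 2 + √2 * v + 1) - Real.log (v ^ 2 - √2 * v + 1))
      atTop (𝓝 0) := by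
  have hinv : Tendsto (fun v : ℝ => v⁻¹) atTop (𝓝 0) := tendsto_inv_atTop_zero
  have h : Tendsto (fun v : ℝ => Real.log ((1 + √2 * v⁻¹ + v⁻¹ ^ 2) / (1 - √2 * v⁻¹ + v⁻¹ ^ 2)))
      atTop (𝓝 (Real.log ((1 + √2 * 0 + 0 ^ 2) / (1 - √2 * 0 + 0 ^ 2)))) := by
    refine Tendsto.log (Tendsto.div ?_ ?_ (by norm_num)) (by norm_num)
    · exact (tendsto_const_nhds.add (hinv.const_mul _)).add (hinv.pow 2)
    · exact (tendsto_const_nhds.sub (hinv.const_mul _)).add (hinv.pow 2)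
  simp only [mul_zero, ne_eq, OfNat.ofNat_ne_zero, not_false_eq_true, zero_pow, add_zero, sub_zero,
    div_one, Real.log_one] at h
  refine h.congr' ?_
  filter_upwards [eventually_gt_atTop 0] with v hv
  obtain ⟨hp, hm, -⟩ := quartic_factor v
  rw [← Real.log_div hp.ne' hm.ne']
  congr 1
  have e1 : 1 + √2 * v⁻¹ + v⁻¹ ^ 2 = (v ^ 2 + √2 * v + 1) / v ^ 2 := by field_simp
  have e2 : 1 - √2 * v⁻¹ + v⁻¹ ^ 2 = (v ^ 2 - √2 * v + 1) / v ^ 2 := by field_simp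
  rw [e1, e2, div_div_div_cancel_right₀ (by positivity)]

theorem tendsto_quartic_arctan :
    Tendsto (fun v : ℝ => Real.arctan (√2 * v + 1) + Real.arctan (√2 * v - 1))
      atTop (𝓝 Real.pi) := by
  have hs : (0 : ℝ) < √2 := by positivity
  have ha : Tendsto Real.arctan atTop (𝓝 (Real.pi / 2)) :=
    Real.tendsto_arctan_atTop.mono_right nhdsWithin_le_nhds
  have hm : Tendsto (fun v : ℝ => √2 * v) atTop atTop := tendsto_id.const_mul_atTop hs
  have := (ha.comp (tendsto_atTop_add_const_right _ 1 hm)).add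
    (ha.comp (tendsto_atTop_add_const_right _ (-1) hm))
  rw [add_halves] at this
  exact this

theorem integral_one_div_quartic :
    IntegrableOn (fun v : ℝ => 1 / (1 + v ^ 4)) (Ioi 0) ∧
      ∫ v in Ioi (0 : ℝ), 1 / (1 + v ^ 4) = Real.pi / (2 * √2) := by
  have hd : ∀ v ∈ Ici (0 : ℝ), HasDerivAt (fun v : ℝ =>
      1 / (4 * √2) * (Real.log (v ^ 2 + √2 * v + 1) - Real.log (v ^ 2 - √2 * v + 1)) +
      1 / (2 * √2) * (Real.arctan (√2 * v + 1) + Real.arctan (√2 * v - 1)))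
      (1 / (1 + v ^ 4)) v := fun v _ => by
    refine (((hasDerivAt_quartic_log v).const_mul (1 / (4 * √2))).add
      ((hasDerivAt_quartic_arctan v).const_mul (1 / (2 * √2)))).congr_deriv ?_
    field_simp
    ring
  have hlim := (tendsto_quartic_log.const_mul (1 / (4 * √2))).add
    (tendsto_quartic_arctan.const_mul (1 / (2 * √2)))
  refine ⟨integrableOn_Ioi_deriv_of_nonneg' hd (fun v _ => by positivity) hlim, ?_⟩
  rw [integral_Ioi_of_hasDerivAt_of_nonneg' hd (fun v _ => by positivity) hlim]
  simp [Real.arctan_neg]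
  ring

theorem integral_sq_div_quartic :
    IntegrableOn (fun v : ℝ => v ^ 2 / (1 + v ^ 4)) (Ioi 0) ∧
      ∫ v in Ioi (0 : ℝ), v ^ 2 / (1 + v ^ 4) = Real.pi / (2 * √2) := by
  have hd : ∀ v ∈ Ici (0 : ℝ), HasDerivAt (fun v : ℝ =>
      -(1 / (4 * √2)) * (Real.log (v ^ 2 + √2 * v + 1) - Real.log (v ^ 2 - √2 * v + 1)) +
      1 / (2 * √2) * (Real.arctan (√2 * v + 1) + Real.arctan (√2 * v - 1)))
      (v ^ 2 / (1 + v ^ 4)) v := fun v _ => by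
    refine (((hasDerivAt_quartic_log v).const_mul (-(1 / (4 * √2)))).add
      ((hasDerivAt_quartic_arctan v).const_mul (1 / (2 * √2)))).congr_deriv ?_
    field_simp
    ring
  have hlim := (tendsto_quartic_log.const_mul (-(1 / (4 * √2)))).add
    (tendsto_quartic_arctan.const_mul (1 / (2 * √2)))
  refine ⟨integrableOn_Ioi_deriv_of_nonneg' hd (fun v _ => by positivity) hlim, ?_⟩
  rw [integral_Ioi_of_hasDerivAt_of_nonneg' hd (fun v _ => by positivity) hlim]
  simp [Real.arctan_neg]
  ring

/-- Rescaling of `∫₀^∞ dv / (1 + v⁴)`. -/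
theorem integral_one_div_quartic_scaled {b : ℝ} (hb : 0 < b) :
    IntegrableOn (fun v : ℝ => 1 / (v ^ 4 + b ^ 4)) (Ioi 0) ∧
      ∫ v in Ioi (0 : ℝ), 1 / (v ^ 4 + b ^ 4) = Real.pi / (2 * √2 * b ^ 3) := by
  have hb' : 0 < b⁻¹ := inv_pos.2 hb
  have e : (fun v : ℝ => 1 / (v ^ 4 + b ^ 4)) =
      fun v => (b ^ 4)⁻¹ * (fun w : ℝ => 1 / (1 + w ^ 4)) (b⁻¹ * v) := by
    ext v
    field_simp
    ring
  have hi := (integrableOn_Ioi_comp_mul_left_iff (fun w : ℝ => 1 / (1 + w ^ 4)) 0 hb').2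
    (by simpa using integral_one_div_quartic.1)
  rw [e]
  refine ⟨hi.const_mul _, ?_⟩
  rw [integral_const_mul, integral_comp_mul_left_Ioi (fun w : ℝ => 1 / (1 + w ^ 4)) 0 hb', mul_zero,
    integral_one_div_quartic.2, smul_eq_mul]
  field_simp

/-- Rescaling of `∫₀^∞ v² dv / (1 + v⁴)`. -/
theorem integral_sq_div_quartic_scaled {b : ℝ} (hb : 0 < b) :
    IntegrableOn (fun v : ℝ => v ^ 2 / (v ^ 4 + b ^ 4)) (Ioi 0) ∧
      ∫ v in Ioi (0 : ℝ), v ^ 2 / (v ^ 4 + b ^ 4) = Real.pi / (2 * √2 * b) := by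
  have hb' : 0 < b⁻¹ := inv_pos.2 hb
  have e : (fun v : ℝ => v ^ 2 / (v ^ 4 + b ^ 4)) =
      fun v => (b ^ 2)⁻¹ * (fun w : ℝ => w ^ 2 / (1 + w ^ 4)) (b⁻¹ * v) := by
    ext v
    field_simp
    ring
  have hi := (integrableOn_Ioi_comp_mul_left_iff (fun w : ℝ => w ^ 2 / (1 + w ^ 4)) 0 hb').2
    (by simpa using integral_sq_div_quartic.1)
  rw [e]
  refine ⟨hi.const_mul _, ?_⟩
  rw [integral_const_mul, integral_comp_mul_left_Ioi (fun w : ℝ => w ^ 2 / (1 + w ^ 4)) 0 hb',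
    mul_zero, integral_sq_div_quartic.2, smul_eq_mul]
  field_simp

theorem integral_one_div_sq_add_sq {a : ℝ} (ha : 0 < a) :
    IntegrableOn (fun v : ℝ => 1 / (a ^ 2 + v ^ 2)) (Ioi 0) ∧
      ∫ v in Ioi (0 : ℝ), 1 / (a ^ 2 + v ^ 2) = Real.pi / (2 * a) := by
  have hd : ∀ v ∈ Ici (0 : ℝ), HasDerivAt (fun v : ℝ => a⁻¹ * Real.arctan (a⁻¹ * v))
      (1 / (a ^ 2 + v ^ 2)) v := fun v _ => by
    have := ((hasDerivAt_id v).const_mul a⁻¹).arctan.const_mul a⁻¹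
    refine this.congr_deriv ?_
    simp only [id]
    field_simp
  have hlim : Tendsto (fun v : ℝ => a⁻¹ * Real.arctan (a⁻¹ * v)) atTop
      (𝓝 (a⁻¹ * (Real.pi / 2))) :=
    ((Real.tendsto_arctan_atTop.mono_right nhdsWithin_le_nhds).comp
      (tendsto_id.const_mul_atTop (inv_pos.2 ha))).const_mul _
  refine ⟨integrableOn_Ioi_deriv_of_nonneg' hd (fun v _ => by positivity) hlim, ?_⟩
  rw [integral_Ioi_of_hasDerivAt_of_nonneg' hd (fun v _ => by positivity) hlim]
  simp
  field_simp

/-- The substitution `y = v²` on the half-line. -/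
theorem integral_Ioi_eq_integral_sq (g : ℝ → ℝ) :
    ∫ y in Ioi (0 : ℝ), g y = ∫ v in Ioi (0 : ℝ), 2 * v * g (v ^ 2) := by
  rw [← integral_comp_rpow_Ioi_of_pos (g := g) (p := 2) (by norm_num)]
  refine setIntegral_congr_fun measurableSet_Ioi fun v _ => ?_
  norm_num

/-! ### Composition integrals of the three kernels -/

/-- Putting `x = a²`, `t = b²`, `y = v²` removes the square roots; partial fractions in `v` then
reduce the integral to the preceding ones. -/
theorem integral_stieltjes_mul_cauchy {x t : ℝ} (hx : 0 < x) (ht : 0 < t) :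
    ∫ y in Ioi (0 : ℝ), 1 / (x + y) * (√(y * t) / (y ^ 2 + t ^ 2)) =
      Real.pi * ((x + t) / (√2 * (x ^ 2 + t ^ 2)) - √(x * t) / (x ^ 2 + t ^ 2)) := by
  obtain ⟨a, ha, rfl⟩ : ∃ a : ℝ, 0 < a ∧ x = a ^ 2 := ⟨√x, by positivity, (Real.sq_sqrt hx.le).symm⟩
  obtain ⟨b, hb, rfl⟩ : ∃ b : ℝ, 0 < b ∧ t = b ^ 2 := ⟨√t, by positivity, (Real.sq_sqrt ht.le).symm⟩
  rw [integral_Ioi_eq_integral_sq]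
  have e : ∀ v ∈ Ioi (0 : ℝ), 2 * v * (1 / (a ^ 2 + v ^ 2) * (√(v ^ 2 * b ^ 2) /
      ((v ^ 2) ^ 2 + (b ^ 2) ^ 2))) = (2 * b / (a ^ 4 + b ^ 4)) *
      (-(a ^ 2) * (1 / (a ^ 2 + v ^ 2)) + (a ^ 2 * (v ^ 2 / (v ^ 4 + b ^ 4)) +
        b ^ 4 * (1 / (v ^ 4 + b ^ 4)))) := fun v hv => by
    have hv : 0 < v := hv
    rw [← mul_pow, Real.sqrt_sq (by positivity)]
    field_simp
    ring
  rw [setIntegral_congr_fun measurableSet_Ioi e, integral_const_mul, integral_add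
    ((integral_one_div_sq_add_sq ha).1.const_mul _)
    (((integral_sq_div_quartic_scaled hb).1.const_mul _).fun_add
      ((integral_one_div_quartic_scaled hb).1.const_mul _)),
    integral_add ((integral_sq_div_quartic_scaled hb).1.const_mul _)
      ((integral_one_div_quartic_scaled hb).1.const_mul _),
    integral_const_mul, integral_const_mul, integral_const_mul, (integral_one_div_sq_add_sq ha).2,
    (integral_sq_div_quartic_scaled hb).2, (integral_one_div_quartic_scaled hb).2,
    ← mul_pow, Real.sqrt_sq (by positivity)]
  field_simp
  ring

/-- The same substitution; the partial fractions divide by `b² - a²`, which excludes the diagonal, a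
null set for each `x`. -/
theorem integral_sum_mul_cauchy {x t : ℝ} (hx : 0 < x) (ht : 0 < t) (hxt : t ≠ x) :
    ∫ y in Ioi (0 : ℝ), (x + y) / (√2 * (x ^ 2 + y ^ 2)) * (√(y * t) / (y ^ 2 + t ^ 2)) =
      Real.pi / 2 * (1 / (x + t)) := by
  obtain ⟨a, ha, rfl⟩ : ∃ a : ℝ, 0 < a ∧ x = a ^ 2 := ⟨√x, by positivity, (Real.sq_sqrt hx.le).symm⟩
  obtain ⟨b, hb, rfl⟩ : ∃ b : ℝ, 0 < b ∧ t = b ^ 2 := ⟨√t, by positivity, (Real.sq_sqrt ht.le).symm⟩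
  rw [integral_Ioi_eq_integral_sq]
  have hne : b ^ 2 - a ^ 2 ≠ 0 := sub_ne_zero.2 hxt
  have e : ∀ v ∈ Ioi (0 : ℝ), 2 * v * ((a ^ 2 + v ^ 2) / (√2 * ((a ^ 2) ^ 2 + (v ^ 2) ^ 2)) *
      (√(v ^ 2 * b ^ 2) / ((v ^ 2) ^ 2 + (b ^ 2) ^ 2))) =
      (2 * b / (√2 * ((b ^ 2 - a ^ 2) * (a ^ 2 + b ^ 2)))) *
      ((-(a ^ 4) * (1 / (v ^ 4 + a ^ 4)) + b ^ 4 * (1 / (v ^ 4 + b ^ 4))) +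
        (a ^ 2 * (v ^ 2 / (v ^ 4 + a ^ 4)) + -(a ^ 2) * (v ^ 2 / (v ^ 4 + b ^ 4)))) :=
      fun v hv => by
    have hv : 0 < v := hv
    rw [← mul_pow, Real.sqrt_sq (by positivity)]
    have h1 : v ^ 4 + a ^ 4 ≠ 0 := by positivity
    have h2 : v ^ 4 + b ^ 4 ≠ 0 := by positivity
    have h3 : a ^ 4 + v ^ 4 ≠ 0 := by positivity
    field_simp
    ring
  have i1 := (integral_one_div_quartic_scaled ha).1.const_mul (-(a ^ 4))
  have i2 := (integral_one_div_quartic_scaled hb).1.const_mul (b ^ 4)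
  have i3 := (integral_sq_div_quartic_scaled ha).1.const_mul (a ^ 2)
  have i4 := (integral_sq_div_quartic_scaled hb).1.const_mul (-(a ^ 2))
  rw [setIntegral_congr_fun measurableSet_Ioi e, integral_const_mul, integral_add (i1.fun_add i2)
    (i3.fun_add i4), integral_add i1 i2, integral_add i3 i4,
    integral_const_mul, integral_const_mul, integral_const_mul, integral_const_mul,
    (integral_sq_div_quartic_scaled hb).2, (integral_one_div_quartic_scaled hb).2,
    (integral_sq_div_quartic_scaled ha).2, (integral_one_div_quartic_scaled ha).2]
  have h2 : √2 ^ 2 = 2 := Real.sq_sqrt (by norm_num)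
  field_simp
  rw [h2]
  ring

/-- The two square roots combine to `y √(xt)`, and what remains is the derivative of a multiple of
`log ((x² + y²) / (y² + t²))`. That logarithm vanishes at infinity, so its value at `y = 0` produces
`log x - log t`. -/
theorem integral_cauchy_mul_cauchy {x t : ℝ} (hx : 0 < x) (ht : 0 < t) (hxt : t ≠ x) :
    ∫ y in Ioi (0 : ℝ), √(x * y) / (x ^ 2 + y ^ 2) * (√(y * t) / (y ^ 2 + t ^ 2)) =
      logKernel x t := by
  have hne : t ^ 2 - x ^ 2 ≠ 0 := by
    rw [sq_sub_sq]
    exact mul_ne_zero (by positivity) (sub_ne_zero.2 hxt)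
  have e : ∀ y ∈ Ioi (0 : ℝ), √(x * y) / (x ^ 2 + y ^ 2) * (√(y * t) / (y ^ 2 + t ^ 2)) =
      √(x * t) * (y / ((x ^ 2 + y ^ 2) * (y ^ 2 + t ^ 2))) := fun y hy => by
    have hy : 0 < y := hy
    have : √(x * y) * √(y * t) = y * √(x * t) := by
      rw [← Real.sqrt_mul (by positivity), show x * y * (y * t) = y ^ 2 * (x * t) by ring,
        Real.sqrt_mul (by positivity), Real.sqrt_sq hy.le]
    rw [div_mul_div_comm, this]
    ring
  have hd : ∀ y ∈ Ici (0 : ℝ), HasDerivAt (fun y : ℝ => 1 / (2 * (t ^ 2 - x ^ 2)) *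
      (Real.log (x ^ 2 + y ^ 2) - Real.log (y ^ 2 + t ^ 2)))
      (y / ((x ^ 2 + y ^ 2) * (y ^ 2 + t ^ 2))) y := fun y _ => by
    have d1 : HasDerivAt (fun y : ℝ => x ^ 2 + y ^ 2) (2 * y) y := by
      simpa using ((hasDerivAt_id y).pow 2).const_add (x ^ 2)
    have d2 : HasDerivAt (fun y : ℝ => y ^ 2 + t ^ 2) (2 * y) y := by
      simpa using ((hasDerivAt_id y).pow 2).add_const (t ^ 2)
    refine (((d1.log (by positivity)).sub (d2.log (by positivity))).const_mul _).congr_deriv ?_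
    field_simp
    ring
  have hlim : Tendsto (fun y : ℝ => 1 / (2 * (t ^ 2 - x ^ 2)) *
      (Real.log (x ^ 2 + y ^ 2) - Real.log (y ^ 2 + t ^ 2))) atTop
      (𝓝 (1 / (2 * (t ^ 2 - x ^ 2)) * 0)) := by
    refine Tendsto.const_mul _ ?_
    have hinv : Tendsto (fun v : ℝ => v⁻¹) atTop (𝓝 0) := tendsto_inv_atTop_zero
    have h : Tendsto (fun v : ℝ => Real.log ((1 + x ^ 2 * v⁻¹ ^ 2) / (1 + t ^ 2 * v⁻¹ ^ 2)))
        atTop (𝓝 (Real.log ((1 + x ^ 2 * 0 ^ 2) / (1 + t ^ 2 * 0 ^ 2)))) := by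
      refine Tendsto.log (Tendsto.div ?_ ?_ (by norm_num)) (by norm_num)
      · exact tendsto_const_nhds.add ((hinv.pow 2).const_mul _)
      · exact tendsto_const_nhds.add ((hinv.pow 2).const_mul _)
    simp only [mul_zero, ne_eq, OfNat.ofNat_ne_zero, not_false_eq_true, zero_pow, add_zero,
      div_one, Real.log_one] at h
    refine h.congr' ?_
    filter_upwards [eventually_gt_atTop 0] with v hv
    rw [← Real.log_div (by positivity) (by positivity)]
    congr 1
    field_simp
    ring
  rw [setIntegral_congr_fun measurableSet_Ioi e, integral_const_mul,
    integral_Ioi_of_hasDerivAt_of_nonneg' hd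
      (fun v hv => by have : 0 < v := hv; positivity) hlim]
  have hne' : x ^ 2 - t ^ 2 ≠ 0 := by rw [← neg_sub]; exact neg_ne_zero.2 hne
  have l1 : Real.log (x ^ 2) = 2 * Real.log x := by simp
  have l2 : Real.log (t ^ 2) = 2 * Real.log t := by simp
  simp only [logKernel, ne_eq, OfNat.ofNat_ne_zero, not_false_eq_true, zero_pow, add_zero, zero_add,
    l1, l2]
  field_simp
  ring

/-! ### The Schur test with weight `t^(-1/2)` -/

/-- A kernel homogeneous of degree `-1` reproduces the weight `t^(-1/2)` up to a factor, and that
factor is the Schur bound. -/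
theorem integral_stieltjes_weight {x : ℝ} (hx : 0 < x) :
    IntegrableOn (fun t : ℝ => 1 / (x + t) * (√t)⁻¹) (Ioi 0) ∧
      ∫ t in Ioi (0 : ℝ), 1 / (x + t) * (√t)⁻¹ = Real.pi * (√x)⁻¹ := by
  have hsx : 0 < √x := by positivity
  -- The square root is not differentiable at `0`, so only one-sided continuity is used at that
  -- endpoint.
  have hc : ContinuousWithinAt (fun t : ℝ => 2 * (√x)⁻¹ * Real.arctan ((√x)⁻¹ * √t)) (Ici 0) 0 := by
    fun_prop
  have hd : ∀ t ∈ Ioi (0 : ℝ), HasDerivAt (fun t : ℝ => 2 * (√x)⁻¹ * Real.arctan ((√x)⁻¹ * √t))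
      (1 / (x + t) * (√t)⁻¹) t := fun t ht => by
    have ht : 0 < t := ht
    refine (((Real.hasDerivAt_sqrt ht.ne').const_mul (√x)⁻¹).arctan.const_mul
      (2 * (√x)⁻¹)).congr_deriv ?_
    rw [mul_pow, inv_pow, Real.sq_sqrt hx.le, Real.sq_sqrt ht.le]
    field_simp
    rw [Real.sq_sqrt hx.le]
  have hlim : Tendsto (fun t : ℝ => 2 * (√x)⁻¹ * Real.arctan ((√x)⁻¹ * √t)) atTop
      (𝓝 (2 * (√x)⁻¹ * (Real.pi / 2))) :=
    ((Real.tendsto_arctan_atTop.mono_right nhdsWithin_le_nhds).comp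
      (Real.tendsto_sqrt_atTop.const_mul_atTop (inv_pos.2 hsx))).const_mul _
  have hn : ∀ t ∈ Ioi (0 : ℝ), 0 ≤ 1 / (x + t) * (√t)⁻¹ := fun t ht => by
    have : 0 < t := ht
    positivity
  refine ⟨integrableOn_Ioi_deriv_of_nonneg hc hd hn hlim, ?_⟩
  rw [integral_Ioi_of_hasDerivAt_of_nonneg hc hd hn hlim]
  simp
  ring

theorem integral_cauchy_weight {x : ℝ} (hx : 0 < x) :
    IntegrableOn (fun t : ℝ => √(x * t) / (x ^ 2 + t ^ 2) * (√t)⁻¹) (Ioi 0) ∧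
      ∫ t in Ioi (0 : ℝ), √(x * t) / (x ^ 2 + t ^ 2) * (√t)⁻¹ = Real.pi / 2 * (√x)⁻¹ := by
  have hsx : 0 < √x := by positivity
  have e : EqOn (fun t : ℝ => √x * (1 / (x ^ 2 + t ^ 2)))
      (fun t : ℝ => √(x * t) / (x ^ 2 + t ^ 2) * (√t)⁻¹) (Ioi 0) := fun t ht => by
    have ht : 0 < t := ht
    have : 0 < √t := by positivity
    simp only [Real.sqrt_mul hx.le]
    field_simp
  refine ⟨IntegrableOn.congr_fun ((integral_one_div_sq_add_sq hx).1.const_mul _) e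
    measurableSet_Ioi, ?_⟩
  rw [← setIntegral_congr_fun measurableSet_Ioi e, integral_const_mul,
    (integral_one_div_sq_add_sq hx).2]
  field_simp
  exact Real.sq_sqrt hx.le

theorem integrableOn_one_div_add_sq {x : ℝ} (hx : 0 < x) :
    IntegrableOn (fun t : ℝ => (1 / (x + t)) ^ 2) (Ioi 0) := by
  have hd : ∀ t ∈ Ici (0 : ℝ), HasDerivAt (fun t : ℝ => -(x + t)⁻¹) ((1 / (x + t)) ^ 2) t :=
      fun t ht => by
    have ht : 0 ≤ t := ht
    refine ((((hasDerivAt_id t).const_add x).inv (by simp; positivity)).neg).congr_deriv ?_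
    simp
    field_simp
  refine integrableOn_Ioi_deriv_of_nonneg' hd (fun t ht => by positivity) (l := -0) ?_
  exact (tendsto_inv_atTop_zero.comp (tendsto_atTop_add_const_left _ x tendsto_id)).neg

/-- A nonnegative symmetric kernel on the half-line satisfying the Schur test with weight `t ^ (-1/2)`
and constant `C`, and with square-integrable sections. -/
structure SchurKernel (K : ℝ → ℝ → ℝ) (C : ℝ) : Prop where
  measurable : Measurable (Function.uncurry K)
  nonneg : ∀ x, 0 < x → ∀ t, 0 < t → 0 ≤ K x t
  symm : ∀ x t, K x t = K t x
  const_nonneg : 0 ≤ C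
  integrable_weight : ∀ x, 0 < x → IntegrableOn (fun t => K x t * (√t)⁻¹) (Ioi 0)
  integral_weight_le : ∀ x, 0 < x → ∫ t in Ioi (0 : ℝ), K x t * (√t)⁻¹ ≤ C * (√x)⁻¹
  memLp : ∀ x, 0 < x → MemLp (K x) 2 halfLine

theorem ae_halfLine_pos : ∀ᵐ x ∂halfLine, 0 < x := ae_restrict_mem measurableSet_Ioi

namespace SchurKernel

variable {K : ℝ → ℝ → ℝ} {C : ℝ}

theorem lintegral_weight_le (h : SchurKernel K C) {x : ℝ} (hx : 0 < x) :
    ∫⁻ t, ENNReal.ofReal (K x t) * ENNReal.ofReal (√t)⁻¹ ∂halfLine ≤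
      ENNReal.ofReal C * ENNReal.ofReal (√x)⁻¹ := by
  have e : ∫⁻ t, ENNReal.ofReal (K x t) * ENNReal.ofReal (√t)⁻¹ ∂halfLine =
      ENNReal.ofReal (∫ t, K x t * (√t)⁻¹ ∂halfLine) := by
    rw [ofReal_integral_eq_lintegral_ofReal (h.integrable_weight x hx)]
    · refine lintegral_congr_ae (ae_halfLine_pos.mono fun t ht => ?_)
      exact (ENNReal.ofReal_mul (h.nonneg x hx t ht)).symm
    · exact ae_halfLine_pos.mono fun t ht => mul_nonneg (h.nonneg x hx t ht) (by positivity)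
  rw [e, ← ENNReal.ofReal_mul h.const_nonneg]
  exact ENNReal.ofReal_le_ofReal (h.integral_weight_le x hx)

/-- Cauchy–Schwarz for the measure `K x t dt`, after writing `g = t^(-1/4) · (t^(1/4) g)`. -/
theorem lintegral_sq_le_weighted (h : SchurKernel K C) {g : ℝ → ℝ≥0∞} (hg : AEMeasurable g halfLine)
    {x : ℝ} (hx : 0 < x) :
    (∫⁻ t, ENNReal.ofReal (K x t) * g t ∂halfLine) ^ 2 ≤
      ENNReal.ofReal C * (ENNReal.ofReal (√x)⁻¹ *
        ∫⁻ t, ENNReal.ofReal (K x t) * (ENNReal.ofReal √t * g t ^ 2) ∂halfLine) := by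
  have hK : Measurable fun t => ENNReal.ofReal (K x t) :=
    (h.measurable.comp measurable_prodMk_left).ennreal_ofReal
  have hw : Measurable fun t : ℝ => ENNReal.ofReal √t := by fun_prop
  have hw' : Measurable fun t : ℝ => ENNReal.ofReal (√t)⁻¹ := by fun_prop
  have key := ENNReal.lintegral_mul_norm_pow_le (μ := halfLine)
    (f := fun t => ENNReal.ofReal (K x t) * ENNReal.ofReal (√t)⁻¹)
    (g := fun t => ENNReal.ofReal (K x t) * (ENNReal.ofReal √t * g t ^ 2))
    (hK.mul hw').aemeasurable (hK.aemeasurable.mul (hw.aemeasurable.mul (hg.pow_const 2)))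
    (p := 1 / 2) (q := 1 / 2) (by norm_num) (by norm_num) (by norm_num)
  have e : ∫⁻ t, ENNReal.ofReal (K x t) * g t ∂halfLine =
      ∫⁻ t, (ENNReal.ofReal (K x t) * ENNReal.ofReal (√t)⁻¹) ^ (1 / 2 : ℝ) *
        (ENNReal.ofReal (K x t) * (ENNReal.ofReal √t * g t ^ 2)) ^ (1 / 2 : ℝ) ∂halfLine := by
    refine lintegral_congr_ae (ae_halfLine_pos.mono fun t ht => ?_)
    have hst : 0 < √t := Real.sqrt_pos.2 ht
    have h1 : ENNReal.ofReal (√t)⁻¹ * ENNReal.ofReal √t = 1 := by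
      rw [← ENNReal.ofReal_mul (by positivity), inv_mul_cancel₀ hst.ne', ENNReal.ofReal_one]
    simp only
    rw [← ENNReal.mul_rpow_of_nonneg _ _ (by norm_num), show
      ENNReal.ofReal (K x t) * ENNReal.ofReal (√t)⁻¹ *
        (ENNReal.ofReal (K x t) * (ENNReal.ofReal √t * g t ^ 2)) =
      (ENNReal.ofReal (√t)⁻¹ * ENNReal.ofReal √t) * (ENNReal.ofReal (K x t) * g t) ^ 2 by ring,
      h1, one_mul, ← ENNReal.rpow_two, ← ENNReal.rpow_mul]
    norm_num
  rw [e]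
  calc _ ≤ _ := pow_le_pow_left' key 2
    _ = (∫⁻ t, ENNReal.ofReal (K x t) * ENNReal.ofReal (√t)⁻¹ ∂halfLine) *
        ∫⁻ t, ENNReal.ofReal (K x t) * (ENNReal.ofReal √t * g t ^ 2) ∂halfLine := by
      rw [← ENNReal.mul_rpow_of_nonneg _ _ (by norm_num), ← ENNReal.rpow_two, ← ENNReal.rpow_mul]
      norm_num
    _ ≤ _ := by
      rw [← mul_assoc]
      gcongr
      exact h.lintegral_weight_le hx

/-- The Schur test. -/
theorem lintegral_sq_le (h : SchurKernel K C) {g : ℝ → ℝ≥0∞} (hg : AEMeasurable g halfLine) :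
    ∫⁻ x, (∫⁻ t, ENNReal.ofReal (K x t) * g t ∂halfLine) ^ 2 ∂halfLine ≤
      ENNReal.ofReal C ^ 2 * ∫⁻ t, g t ^ 2 ∂halfLine := by
  have hK : Measurable fun p : ℝ × ℝ => ENNReal.ofReal (K p.1 p.2) := h.measurable.ennreal_ofReal
  have hw : Measurable fun t : ℝ => ENNReal.ofReal √t := by fun_prop
  have hw' : Measurable fun t : ℝ => ENNReal.ofReal (√t)⁻¹ := by fun_prop
  calc _ ≤ ∫⁻ x, ENNReal.ofReal C * ∫⁻ t, ENNReal.ofReal (√x)⁻¹ *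
        (ENNReal.ofReal (K x t) * (ENNReal.ofReal √t * g t ^ 2)) ∂halfLine ∂halfLine := by
        refine lintegral_mono_ae (ae_halfLine_pos.mono fun x hx => ?_)
        refine (h.lintegral_sq_le_weighted hg hx).trans_eq ?_
        rw [lintegral_const_mul' _ _ ENNReal.ofReal_ne_top]
    _ = ENNReal.ofReal C * ∫⁻ t, ∫⁻ x, ENNReal.ofReal (√x)⁻¹ *
        (ENNReal.ofReal (K x t) * (ENNReal.ofReal √t * g t ^ 2)) ∂halfLine ∂halfLine := by
        have hm : AEMeasurable (Function.uncurry fun x t : ℝ => ENNReal.ofReal (√x)⁻¹ *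
            (ENNReal.ofReal (K x t) * (ENNReal.ofReal √t * g t ^ 2)))
            (halfLine.prod halfLine) :=
          (hw'.comp measurable_fst).aemeasurable.mul (hK.aemeasurable.mul
            ((hw.comp measurable_snd).aemeasurable.mul (hg.comp_snd.pow_const 2)))
        rw [lintegral_const_mul' _ _ ENNReal.ofReal_ne_top, lintegral_lintegral_swap hm]
    -- By symmetry of `K` the inner integral in `x` is again the kernel against the weight; the
    -- resulting `t^(-1/2)` cancels the factor `√t`.
    _ ≤ ENNReal.ofReal C * ∫⁻ t, ENNReal.ofReal C * g t ^ 2 ∂halfLine := by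
        gcongr ENNReal.ofReal C * ?_
        refine lintegral_mono_ae (ae_halfLine_pos.mono fun t ht => ?_)
        have hst : 0 < √t := Real.sqrt_pos.2 ht
        have h1 : ENNReal.ofReal (√t)⁻¹ * ENNReal.ofReal √t = 1 := by
          rw [← ENNReal.ofReal_mul (by positivity), inv_mul_cancel₀ hst.ne', ENNReal.ofReal_one]
        calc _ = ∫⁻ x, (ENNReal.ofReal (K t x) * ENNReal.ofReal (√x)⁻¹) *
              (ENNReal.ofReal √t * g t ^ 2) ∂halfLine := by
              refine lintegral_congr fun x => ?_
              rw [h.symm x t]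
              ring
          _ = (∫⁻ x, ENNReal.ofReal (K t x) * ENNReal.ofReal (√x)⁻¹ ∂halfLine) *
              (ENNReal.ofReal √t * g t ^ 2) :=
              lintegral_mul_const _ ((hK.comp measurable_prodMk_left).mul hw')
          _ ≤ (ENNReal.ofReal C * ENNReal.ofReal (√t)⁻¹) * (ENNReal.ofReal √t * g t ^ 2) := by
              gcongr
              exact h.lintegral_weight_le ht
          _ = ENNReal.ofReal C * (ENNReal.ofReal (√t)⁻¹ * ENNReal.ofReal √t) * g t ^ 2 := by ring
          _ = _ := by rw [h1, mul_one]
    _ = _ := by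
        rw [lintegral_const_mul'' _ (hg.pow_const 2)]
        ring

theorem integrable_mul (h : SchurKernel K C) {f : ℝ → ℂ} (hf : MemLp f 2 halfLine) {x : ℝ}
    (hx : 0 < x) : Integrable (fun t => (K x t : ℂ) * f t) halfLine :=
  MemLp.integrable_mul (p := 2) (q := 2) (h.memLp x hx).ofReal hf

theorem enorm_integral_le (h : SchurKernel K C) (f : ℝ → ℂ) {x : ℝ} (hx : 0 < x) :
    ‖∫ t, (K x t : ℂ) * f t ∂halfLine‖ₑ ≤
      ∫⁻ t, ENNReal.ofReal (K x t) * ‖f t‖ₑ ∂halfLine := by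
  refine (enorm_integral_le_lintegral_enorm _).trans_eq
    (lintegral_congr_ae (ae_halfLine_pos.mono fun t ht => ?_))
  simp only [enorm_mul]
  rw [← ofReal_norm (K x t : ℂ), Complex.norm_real,
    Real.norm_of_nonneg (h.nonneg x hx t ht)]

theorem aestronglyMeasurable_integral (h : SchurKernel K C) {f : ℝ → ℂ}
    (hf : AEStronglyMeasurable f halfLine) :
    AEStronglyMeasurable (fun x => ∫ t, (K x t : ℂ) * f t ∂halfLine) halfLine :=
  AEStronglyMeasurable.integral_prod_right' (f := fun p : ℝ × ℝ => (K p.1 p.2 : ℂ) * f p.2)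
    ((Complex.measurable_ofReal.comp h.measurable).aestronglyMeasurable.mul hf.comp_snd)

theorem eLpNorm_integral_le (h : SchurKernel K C) {f : ℝ → ℂ}
    (hf : AEStronglyMeasurable f halfLine) :
    eLpNorm (fun x => ∫ t, (K x t : ℂ) * f t ∂halfLine) 2 halfLine ≤
      ENNReal.ofReal C * eLpNorm f 2 halfLine := by
  rw [eLpNorm_eq_lintegral_rpow_enorm_toReal (by norm_num) (by norm_num),
    eLpNorm_eq_lintegral_rpow_enorm_toReal (by norm_num) (by norm_num)]
  simp only [ENNReal.toReal_ofNat, ENNReal.rpow_ofNat]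
  have h1 : ENNReal.ofReal C = (ENNReal.ofReal C ^ 2) ^ (1 / 2 : ℝ) := by
    rw [← ENNReal.rpow_two, ← ENNReal.rpow_mul]
    norm_num
  rw [h1, ← ENNReal.mul_rpow_of_nonneg _ _ (by norm_num)]
  refine ENNReal.rpow_le_rpow ?_ (by norm_num)
  refine le_trans (lintegral_mono_ae (ae_halfLine_pos.mono fun x hx => ?_))
    (h.lintegral_sq_le hf.enorm)
  exact pow_le_pow_left' (h.enorm_integral_le f hx) 2

theorem memLp_integral (h : SchurKernel K C) {f : ℝ → ℂ} (hf : MemLp f 2 halfLine) :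
    MemLp (fun x => ∫ t, (K x t : ℂ) * f t ∂halfLine) 2 halfLine :=
  ⟨h.aestronglyMeasurable_integral hf.1, (h.eLpNorm_integral_le hf.1).trans_lt
    (ENNReal.mul_lt_top ENNReal.ofReal_lt_top hf.2)⟩

/-- The bounded operator on `L₂(ℝ₊)` with a given Schur kernel. -/
noncomputable def op (h : SchurKernel K C) : L2HalfLine →L[ℂ] L2HalfLine :=
  LinearMap.mkContinuous
    { toFun := fun f => (h.memLp_integral (Lp.memLp f)).toLp _
      map_add' := fun f g => by
        rw [← MemLp.toLp_add, MemLp.toLp_eq_toLp_iff]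
        filter_upwards [ae_halfLine_pos] with x hx
        rw [Pi.add_apply, ← integral_add (h.integrable_mul (Lp.memLp f) hx)
          (h.integrable_mul (Lp.memLp g) hx)]
        refine integral_congr_ae ?_
        filter_upwards [Lp.coeFn_add f g] with t ht
        rw [ht, Pi.add_apply, mul_add]
      map_smul' := fun c f => by
        rw [← MemLp.toLp_const_smul, MemLp.toLp_eq_toLp_iff]
        refine Eventually.of_forall fun x => ?_
        rw [RingHom.id_apply, Pi.smul_apply, ← integral_smul]
        refine integral_congr_ae ?_
        filter_upwards [Lp.coeFn_smul c f] with t ht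
        rw [ht, Pi.smul_apply, smul_eq_mul, smul_eq_mul]
        ring } C fun f => by
    simp only [LinearMap.coe_mk, AddHom.coe_mk, Lp.norm_toLp]
    rw [Lp.norm_def, ← ENNReal.toReal_ofReal h.const_nonneg, ← ENNReal.toReal_mul]
    refine ENNReal.toReal_mono (ENNReal.mul_ne_top ENNReal.ofReal_ne_top (Lp.eLpNorm_ne_top f)) ?_
    exact h.eLpNorm_integral_le (Lp.aestronglyMeasurable f)

theorem op_apply (h : SchurKernel K C) (f : L2HalfLine) :
    h.op f =ᵐ[halfLine] fun x => ∫ t, (K x t : ℂ) * f t ∂halfLine :=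
  MemLp.coeFn_toLp (h.memLp_integral (Lp.memLp f))

theorem norm_op_le (h : SchurKernel K C) : ‖h.op‖ ≤ C :=
  LinearMap.mkContinuous_norm_le _ h.const_nonneg _

/-- The Fubini hypothesis for composing kernels, at every `x > 0`: `K'` applied to `|f|` is in `L₂`
by the Schur test, and it is paired with the `L₂` section `K x`. -/
theorem integrable_triple (h : SchurKernel K C) {K' : ℝ → ℝ → ℝ} {C' : ℝ} (h' : SchurKernel K' C')
    {f : ℝ → ℂ} (hf : MemLp f 2 halfLine) {x : ℝ} (hx : 0 < x) :
    Integrable (fun p : ℝ × ℝ => (K x p.1 : ℂ) * ((K' p.1 p.2 : ℂ) * f p.2))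
      (halfLine.prod halfLine) := by
  have hm : AEStronglyMeasurable (fun p : ℝ × ℝ => (K x p.1 : ℂ) * ((K' p.1 p.2 : ℂ) * f p.2))
      (halfLine.prod halfLine) :=
    (Complex.measurable_ofReal.comp ((h.measurable.comp measurable_prodMk_left).comp
      measurable_fst)).aestronglyMeasurable.mul
      ((Complex.measurable_ofReal.comp h'.measurable).aestronglyMeasurable.mul hf.1.comp_snd)
  rw [integrable_prod_iff hm]
  refine ⟨ae_halfLine_pos.mono fun y hy => (h'.integrable_mul hf hy).const_mul (K x y : ℂ), ?_⟩
  have hn : MemLp (fun t => (‖f t‖ : ℂ)) 2 halfLine := hf.norm.ofReal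
  refine (h.integrable_mul (h'.memLp_integral hn) hx).norm.congr ?_
  filter_upwards [ae_halfLine_pos] with y hy
  have e : ∫ t, (K' y t : ℂ) * (‖f t‖ : ℂ) ∂halfLine =
      ((∫ t, K' y t * ‖f t‖ ∂halfLine : ℝ) : ℂ) := by
    rw [← integral_complex_ofReal]
    simp
  have hp : 0 ≤ ∫ t, K' y t * ‖f t‖ ∂halfLine :=
    integral_nonneg_of_ae (ae_halfLine_pos.mono fun t ht =>
      mul_nonneg (h'.nonneg y hy t ht) (norm_nonneg _))
  rw [e, norm_mul, Complex.norm_real, Complex.norm_real, Real.norm_of_nonneg hp,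
    ← integral_const_mul]
  refine integral_congr_ae (ae_halfLine_pos.mono fun t ht => ?_)
  simp only [norm_mul, Complex.norm_real]
  rw [Real.norm_of_nonneg (h'.nonneg y hy t ht)]

/-- Composition of two kernels, at every point of the half-line. -/
theorem integral_comp (h : SchurKernel K C) {K' : ℝ → ℝ → ℝ} {C' : ℝ} (h' : SchurKernel K' C')
    {f : ℝ → ℂ} (hf : MemLp f 2 halfLine) {x : ℝ} (hx : 0 < x) {m : ℝ → ℝ}
    (hm : ∀ᵐ t ∂halfLine, ∫ y in Ioi (0 : ℝ), K x y * K' y t = m t) :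
    Integrable (fun t => (m t : ℂ) * f t) halfLine ∧
      ∫ y, (K x y : ℂ) * ∫ t, (K' y t : ℂ) * f t ∂halfLine ∂halfLine =
        ∫ t, (m t : ℂ) * f t ∂halfLine := by
  have hi := h.integrable_triple h' hf hx
  have e : (fun t => ∫ y, (K x y : ℂ) * ((K' y t : ℂ) * f t) ∂halfLine) =ᵐ[halfLine]
      fun t => (m t : ℂ) * f t := by
    filter_upwards [hm] with t ht
    rw [← ht, ← integral_complex_ofReal, ← integral_mul_const]
    refine integral_congr_ae (Eventually.of_forall fun y => ?_)
    push_cast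
    ring
  refine ⟨hi.integral_prod_right.congr e, ?_⟩
  rw [← integral_congr_ae e, ← integral_integral_swap hi]
  refine integral_congr_ae (Eventually.of_forall fun y => ?_)
  exact (integral_const_mul _ _).symm

theorem op_comp_apply (h : SchurKernel K C) {K' : ℝ → ℝ → ℝ} {C' : ℝ} (h' : SchurKernel K' C')
    {M : ℝ → ℝ → ℝ} (hM : ∀ x, 0 < x → ∀ᵐ t ∂halfLine, ∫ y in Ioi (0 : ℝ), K x y * K' y t = M x t)
    (f : L2HalfLine) :
    h.op (h'.op f) =ᵐ[halfLine] fun x => ∫ t, (M x t : ℂ) * f t ∂halfLine := by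
  filter_upwards [h.op_apply (h'.op f), ae_halfLine_pos] with x hx hpos
  rw [hx, ← (h.integral_comp h' (Lp.memLp f) hpos (hM x hpos)).2]
  refine integral_congr_ae ?_
  filter_upwards [h'.op_apply f] with y hy
  rw [hy]

/-- A kernel dominated by a Schur kernel is a Schur kernel. -/
theorem of_le (h : SchurKernel K C) {K' : ℝ → ℝ → ℝ} (hm : Measurable (Function.uncurry K'))
    (hn : ∀ x, 0 < x → ∀ t, 0 < t → 0 ≤ K' x t) (hs : ∀ x t, K' x t = K' t x) {c : ℝ} (hc : 0 ≤ c)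
    (hle : ∀ x, 0 < x → ∀ t, 0 < t → K' x t ≤ c * K x t) : SchurKernel K' (c * C) := by
  have hmx : ∀ x, Measurable (K' x) := fun x => hm.comp measurable_prodMk_left
  have hi : ∀ x, 0 < x → IntegrableOn (fun t => K' x t * (√t)⁻¹) (Ioi 0) := fun x hx => by
    refine Integrable.mono' ((h.integrable_weight x hx).const_mul c)
      ((hmx x).mul (by fun_prop)).aestronglyMeasurable (ae_halfLine_pos.mono fun t ht => ?_)
    have hst : 0 ≤ (√t)⁻¹ := by positivity
    rw [Real.norm_of_nonneg (mul_nonneg (hn x hx t ht) hst), ← mul_assoc]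
    exact mul_le_mul_of_nonneg_right (hle x hx t ht) hst
  refine ⟨hm, hn, hs, mul_nonneg hc h.const_nonneg, hi, fun x hx => ?_, fun x hx => ?_⟩
  · calc _ ≤ ∫ t in Ioi (0 : ℝ), c * (K x t * (√t)⁻¹) := by
          refine integral_mono_ae (hi x hx) ((h.integrable_weight x hx).const_mul c)
            (ae_halfLine_pos.mono fun t ht => ?_)
          simp only
          rw [← mul_assoc]
          exact mul_le_mul_of_nonneg_right (hle x hx t ht) (by positivity)
      _ = c * ∫ t in Ioi (0 : ℝ), K x t * (√t)⁻¹ := integral_const_mul _ _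
      _ ≤ c * (C * (√x)⁻¹) := mul_le_mul_of_nonneg_left (h.integral_weight_le x hx) hc
      _ = _ := by ring
  · refine MemLp.mono' ((h.memLp x hx).const_mul c) (hmx x).aestronglyMeasurable
      (ae_halfLine_pos.mono fun t ht => ?_)
    rw [Real.norm_of_nonneg (hn x hx t ht)]
    exact hle x hx t ht

end SchurKernel

/-! ### The three operators and their products -/

theorem schurKernel_stieltjes : SchurKernel (fun x t => 1 / (x + t)) Real.pi where
  measurable := by
    unfold Function.uncurry
    fun_prop
  nonneg x hx t ht := by positivity
  symm x t := by rw [add_comm]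
  const_nonneg := Real.pi_pos.le
  integrable_weight x hx := (integral_stieltjes_weight hx).1
  integral_weight_le x hx := (integral_stieltjes_weight hx).2.le
  memLp x hx := (memLp_two_iff_integrable_sq (by
    have : Measurable fun t : ℝ => 1 / (x + t) := by fun_prop
    exact this.aestronglyMeasurable)).2 (integrableOn_one_div_add_sq hx)

/-- Domination by the Stieltjes kernel supplies everything but the constant, which would be `π`. The
exact weight integral improves it to `π/2`; with `π` the bound on the inverse would exceed `1`. -/
theorem schurKernel_cauchy : SchurKernel (fun x t => √(x * t) / (x ^ 2 + t ^ 2)) (Real.pi / 2) := by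
  have h := schurKernel_stieltjes.of_le (K' := fun x t => √(x * t) / (x ^ 2 + t ^ 2)) (by
    unfold Function.uncurry
    fun_prop) (fun x hx t ht => by positivity) (fun x t => by rw [mul_comm, add_comm])
    (c := 1) zero_le_one (fun x hx t ht => by
      have h1 : √(x * t) ≤ (x + t) / 2 := Real.sqrt_le_iff.2
        ⟨by positivity, by nlinarith [sq_nonneg (x - t)]⟩
      rw [one_mul, div_le_div_iff₀ (by positivity) (by positivity)]
      nlinarith [mul_le_mul_of_nonneg_right h1 (by positivity : 0 ≤ x + t), sq_nonneg (x - t)])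
  exact { h with
    const_nonneg := by positivity
    integral_weight_le := fun x hx => (integral_cauchy_weight hx).2.le }

/-- The factor `√2` comes from `(x + t)² ≤ 2 (x² + t²)`. Only boundedness of this auxiliary operator
matters. -/
theorem schurKernel_sum :
    SchurKernel (fun x t => (x + t) / (√2 * (x ^ 2 + t ^ 2))) (√2 * Real.pi) :=
  schurKernel_stieltjes.of_le (by
    unfold Function.uncurry
    fun_prop) (fun x hx t ht => by positivity)
    (fun x t => by rw [add_comm, add_comm (x ^ 2)]) (by positivity) (fun x hx t ht => by
      have h2 : √2 * √2 = 2 := Real.mul_self_sqrt (by norm_num)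
      rw [mul_one_div, div_le_div_iff₀ (by positivity) (by positivity)]
      nlinarith [sq_nonneg (x - t)])

/-- The Stieltjes operator, with kernel `1 / (x + t)`. -/
noncomputable def stieltjesOp : L2HalfLine →L[ℂ] L2HalfLine := schurKernel_stieltjes.op

/-- The operator with kernel `√(x t) / (x² + t²)`. -/
noncomputable def cauchyOp : L2HalfLine →L[ℂ] L2HalfLine := schurKernel_cauchy.op

/-- The operator with kernel `(x + t) / (√2 (x² + t²))`. -/
noncomputable def sumOp : L2HalfLine →L[ℂ] L2HalfLine := schurKernel_sum.op

theorem ae_halfLine_ne (x : ℝ) : ∀ᵐ t ∂halfLine, t ≠ x :=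
  ae_restrict_of_ae (Measure.ae_ne volume x)

theorem integral_sub_kernel (f : L2HalfLine) {x : ℝ} (hx : 0 < x) :
    ∫ t, ((Real.pi * ((x + t) / (√2 * (x ^ 2 + t ^ 2)) - √(x * t) / (x ^ 2 + t ^ 2)) : ℝ) : ℂ) * f t
      ∂halfLine = Real.pi * ((∫ t, (((x + t) / (√2 * (x ^ 2 + t ^ 2)) : ℝ) : ℂ) * f t ∂halfLine) -
        ∫ t, ((√(x * t) / (x ^ 2 + t ^ 2) : ℝ) : ℂ) * f t ∂halfLine) := by
  rw [← integral_sub (schurKernel_sum.integrable_mul (Lp.memLp f) hx)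
    (schurKernel_cauchy.integrable_mul (Lp.memLp f) hx), ← integral_const_mul]
  refine integral_congr_ae (Eventually.of_forall fun t => ?_)
  simp only [Complex.ofReal_mul, Complex.ofReal_sub]
  ring

theorem ae_eq_smul_sub {f g : L2HalfLine}
    (h : g =ᵐ[halfLine] fun x => ∫ t, ((Real.pi * ((x + t) / (√2 * (x ^ 2 + t ^ 2)) -
      √(x * t) / (x ^ 2 + t ^ 2)) : ℝ) : ℂ) * f t ∂halfLine) :
    g = (Real.pi : ℂ) • (sumOp f - cauchyOp f) := by
  refine Lp.ext ?_
  filter_upwards [h, Lp.coeFn_smul (Real.pi : ℂ) (sumOp f - cauchyOp f),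
    Lp.coeFn_sub (sumOp f) (cauchyOp f), schurKernel_sum.op_apply f,
    schurKernel_cauchy.op_apply f, ae_halfLine_pos] with x h1 h2 h3 h4 h5 hx
  rw [h1, h2, Pi.smul_apply, h3, Pi.sub_apply, sumOp, cauchyOp, h4, h5, integral_sub_kernel f hx,
    smul_eq_mul]

theorem stieltjesOp_comp_cauchyOp (f : L2HalfLine) :
    stieltjesOp (cauchyOp f) = (Real.pi : ℂ) • (sumOp f - cauchyOp f) :=
  ae_eq_smul_sub (schurKernel_stieltjes.op_comp_apply schurKernel_cauchy (fun _ hx =>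
    ae_halfLine_pos.mono fun _ ht => integral_stieltjes_mul_cauchy hx ht) f)

/-- All kernels are symmetric, so the reversed product follows from the same integral with `x` and
`t` exchanged. -/
theorem cauchyOp_comp_stieltjesOp (f : L2HalfLine) :
    cauchyOp (stieltjesOp f) = (Real.pi : ℂ) • (sumOp f - cauchyOp f) :=
  ae_eq_smul_sub (schurKernel_cauchy.op_comp_apply schurKernel_stieltjes (fun x hx =>
    ae_halfLine_pos.mono fun t ht => by
      have := integral_stieltjes_mul_cauchy ht hx
      rw [add_comm t x, add_comm (t ^ 2), mul_comm t x] at this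
      rw [← this]
      refine integral_congr_ae (Eventually.of_forall fun y => ?_)
      simp only
      rw [mul_comm x y, add_comm (x ^ 2), add_comm y t, mul_comm]) f)

theorem ae_eq_smul_stieltjesOp {f g : L2HalfLine}
    (h : g =ᵐ[halfLine] fun x => ∫ t, ((Real.pi / 2 * (1 / (x + t)) : ℝ) : ℂ) * f t ∂halfLine) :
    g = (Real.pi / 2 : ℂ) • stieltjesOp f := by
  refine Lp.ext ?_
  filter_upwards [h, Lp.coeFn_smul (Real.pi / 2 : ℂ) (stieltjesOp f),
    schurKernel_stieltjes.op_apply f] with x h1 h2 h3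
  rw [h1, h2, Pi.smul_apply, stieltjesOp, h3, smul_eq_mul, ← integral_const_mul]
  refine integral_congr_ae (Eventually.of_forall fun t => ?_)
  push_cast
  ring

theorem sumOp_comp_cauchyOp (f : L2HalfLine) :
    sumOp (cauchyOp f) = (Real.pi / 2 : ℂ) • stieltjesOp f :=
  ae_eq_smul_stieltjesOp (schurKernel_sum.op_comp_apply schurKernel_cauchy (fun x hx => by
    filter_upwards [ae_halfLine_pos, ae_halfLine_ne x] with t ht hne
    exact integral_sum_mul_cauchy hx ht hne) f)

theorem cauchyOp_comp_sumOp (f : L2HalfLine) :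
    cauchyOp (sumOp f) = (Real.pi / 2 : ℂ) • stieltjesOp f :=
  ae_eq_smul_stieltjesOp (schurKernel_cauchy.op_comp_apply schurKernel_sum (fun x hx => by
    filter_upwards [ae_halfLine_pos, ae_halfLine_ne x] with t ht hne
    have := integral_sum_mul_cauchy ht hx hne.symm
    rw [add_comm t x] at this
    rw [← this]
    refine integral_congr_ae (Eventually.of_forall fun y => ?_)
    simp only
    rw [mul_comm x y, add_comm (x ^ 2), add_comm y t, add_comm (y ^ 2) (t ^ 2), mul_comm]) f)

theorem ae_integral_cauchy_mul_cauchy {x : ℝ} (hx : 0 < x) :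
    ∀ᵐ t ∂halfLine, ∫ y in Ioi (0 : ℝ), √(x * y) / (x ^ 2 + y ^ 2) * (√(y * t) / (y ^ 2 + t ^ 2)) =
      logKernel x t := by
  filter_upwards [ae_halfLine_pos, ae_halfLine_ne x] with t ht hne
  exact integral_cauchy_mul_cauchy hx ht hne

theorem integrableOn_logKernel_mul {f : ℝ → ℂ} (hf : MemLp f 2 halfLine) {x : ℝ} (hx : 0 < x) :
    IntegrableOn (fun t => (logKernel x t : ℂ) * f t) (Ioi 0) :=
  (schurKernel_cauchy.integral_comp schurKernel_cauchy hf hx (ae_integral_cauchy_mul_cauchy hx)).1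

theorem cauchyOp_cauchyOp_apply (f : L2HalfLine) :
    cauchyOp (cauchyOp f) =ᵐ[halfLine] fun x => ∫ t in Ioi (0 : ℝ), (logKernel x t : ℂ) * f t :=
  schurKernel_cauchy.op_comp_apply schurKernel_cauchy
    (fun _ hx => ae_integral_cauchy_mul_cauchy hx) f

/-! ### The operator `T`, its inverse and their norms -/

/-- The operator `f ↦ 2 f + (2/π) ∫ f(t)/(x+t) dt`. -/
noncomputable def hartleySqOp : L2HalfLine →L[ℂ] L2HalfLine :=
  (2 : ℂ) • ContinuousLinearMap.id ℂ L2HalfLine + (2 / Real.pi : ℂ) • stieltjesOp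

/-- The inverse of `hartleySqOp`. -/
noncomputable def hartleySqInvOp : L2HalfLine →L[ℂ] L2HalfLine :=
  (1 / 2 : ℂ) • ContinuousLinearMap.id ℂ L2HalfLine -
    (1 / (Real.pi : ℂ) ^ 2) • cauchyOp.comp cauchyOp

theorem hartleySqOp_apply (f : L2HalfLine) :
    hartleySqOp f = (2 : ℂ) • f + (2 / Real.pi : ℂ) • stieltjesOp f := rfl

theorem hartleySqInvOp_apply (f : L2HalfLine) :
    hartleySqInvOp f = (1 / 2 : ℂ) • f - (1 / (Real.pi : ℂ) ^ 2) • cauchyOp (cauchyOp f) := rfl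

/-- The product table gives `S P² = π (Q P - P²) = (π²/2) S - π P²`, and all terms except the
identity cancel. -/
theorem hartleySqOp_hartleySqInvOp (f : L2HalfLine) : hartleySqOp (hartleySqInvOp f) = f := by
  have hpi : (Real.pi : ℂ) ≠ 0 := Complex.ofReal_ne_zero.2 Real.pi_ne_zero
  rw [hartleySqOp_apply, hartleySqInvOp_apply, map_sub, map_smul, map_smul,
    stieltjesOp_comp_cauchyOp, sumOp_comp_cauchyOp]
  match_scalars <;> field_simp <;> ring

theorem hartleySqInvOp_hartleySqOp (f : L2HalfLine) : hartleySqInvOp (hartleySqOp f) = f := by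
  have hpi : (Real.pi : ℂ) ≠ 0 := Complex.ofReal_ne_zero.2 Real.pi_ne_zero
  rw [hartleySqOp_apply, hartleySqInvOp_apply, map_add, map_smul, map_smul, map_add, map_smul,
    map_smul, cauchyOp_comp_stieltjesOp, map_smul, map_sub, cauchyOp_comp_sumOp]
  match_scalars <;> field_simp <;> ring

/-- `hartleySqOp` as a continuous linear equivalence. -/
noncomputable def hartleySqEquiv : L2HalfLine ≃L[ℂ] L2HalfLine :=
  ContinuousLinearEquiv.equivOfInverse hartleySqOp hartleySqInvOp hartleySqInvOp_hartleySqOp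
    hartleySqOp_hartleySqInvOp

theorem norm_hartleySqOp_le (f : L2HalfLine) : ‖hartleySqOp f‖ ≤ 4 * ‖f‖ := by
  have h1 := schurKernel_stieltjes.op.le_of_opNorm_le schurKernel_stieltjes.norm_op_le f
  have hpi := Real.pi_pos
  rw [hartleySqOp_apply]
  refine (norm_add_le _ _).trans ?_
  rw [norm_smul, norm_smul, norm_div, Complex.norm_real, Real.norm_of_nonneg hpi.le,
    Complex.norm_ofNat]
  calc _ ≤ 2 * ‖f‖ + 2 / Real.pi * (Real.pi * ‖f‖) := by gcongr; exact h1
    _ = _ := by field_simp; ring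

theorem norm_hartleySqInvOp_le (f : L2HalfLine) : ‖hartleySqInvOp f‖ ≤ ‖f‖ := by
  have h1 := fun f => schurKernel_cauchy.op.le_of_opNorm_le schurKernel_cauchy.norm_op_le f
  have hpi := Real.pi_pos
  rw [hartleySqInvOp_apply]
  refine (norm_sub_le _ _).trans ?_
  rw [norm_smul, norm_smul, norm_div, norm_div, norm_pow, Complex.norm_real,
    Real.norm_of_nonneg hpi.le, Complex.norm_ofNat, norm_one]
  -- Two applications of `‖P‖ ≤ π/2` contribute `1/4`, which leaves room below `1`.
  calc _ ≤ 1 / 2 * ‖f‖ + 1 / Real.pi ^ 2 * (Real.pi / 2 * (Real.pi / 2 * ‖f‖)) := by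
        gcongr
        exact (h1 _).trans (by gcongr; exact h1 f)
    _ = 3 / 4 * ‖f‖ := by field_simp; ring
    _ ≤ ‖f‖ := by linarith [norm_nonneg f]

/-! ### The half-Hartley transform on integrable and on test functions -/

/-- The kernel `cos(xt) + sin(xt)`. -/
noncomputable def cas (x t : ℝ) : ℝ := Real.cos (x * t) + Real.sin (x * t)

theorem halfHartley_eq (f : ℝ → ℂ) (x : ℝ) :
    halfHartley f x = (√(2 / Real.pi) : ℂ) * ∫ t, (cas x t : ℂ) * f t ∂halfLine := rfl

theorem cas_comm (x t : ℝ) : cas x t = cas t x := by simp only [cas, mul_comm]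

theorem abs_cas_le (x t : ℝ) : |cas x t| ≤ 2 :=
  (abs_add_le _ _).trans (by linarith [Real.abs_cos_le_one (x * t), Real.abs_sin_le_one (x * t)])

theorem norm_cas_le (x t : ℝ) : ‖(cas x t : ℂ)‖ ≤ 2 := by
  rw [Complex.norm_real]
  exact abs_cas_le x t

theorem continuous_cas : Continuous fun p : ℝ × ℝ => cas p.1 p.2 := by
  unfold cas
  fun_prop

theorem integrable_cas_mul {f : ℝ → ℂ} {μ : Measure ℝ} (hf : Integrable f μ) (x : ℝ) :
    Integrable (fun t => (cas x t : ℂ) * f t) μ :=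
  hf.bdd_mul (Complex.continuous_ofReal.comp (continuous_cas.comp
    (Continuous.prodMk_right x))).aestronglyMeasurable
    (Eventually.of_forall fun t => norm_cas_le x t)

theorem norm_integral_cas_le {f : ℝ → ℂ} {μ : Measure ℝ} (hf : Integrable f μ) (x : ℝ) :
    ‖∫ t, (cas x t : ℂ) * f t ∂μ‖ ≤ 2 * ∫ t, ‖f t‖ ∂μ := by
  rw [← integral_const_mul]
  refine norm_integral_le_of_norm_le (hf.norm.const_mul 2) (Eventually.of_forall fun t => ?_)
  rw [norm_mul]
  exact mul_le_mul_of_nonneg_right (norm_cas_le x t) (norm_nonneg _)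

theorem aestronglyMeasurable_halfHartley {f : ℝ → ℂ} (hf : AEStronglyMeasurable f halfLine) :
    AEStronglyMeasurable (halfHartley f) halfLine :=
  (AEStronglyMeasurable.integral_prod_right' (f := fun p : ℝ × ℝ => (cas p.1 p.2 : ℂ) * f p.2)
    ((Complex.continuous_ofReal.comp continuous_cas).aestronglyMeasurable.mul
      hf.comp_snd)).const_mul _

/-- The half-Hartley transform is symmetric on `L₁`. -/
theorem integral_halfHartley_mul {f g : ℝ → ℂ} (hf : Integrable f halfLine)
    (hg : Integrable g halfLine) :
    ∫ x, halfHartley f x * g x ∂halfLine = ∫ x, f x * halfHartley g x ∂halfLine := by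
  have hi : Integrable (Function.uncurry fun x t : ℝ => (cas x t : ℂ) * (g x * f t))
      (halfLine.prod halfLine) :=
    (hg.mul_prod hf).bdd_mul (Complex.continuous_ofReal.comp continuous_cas).aestronglyMeasurable
      (Eventually.of_forall fun p => norm_cas_le p.1 p.2)
  calc ∫ x, halfHartley f x * g x ∂halfLine
      = (√(2 / Real.pi) : ℂ) * ∫ x, ∫ t, (cas x t : ℂ) * (g x * f t) ∂halfLine ∂halfLine := by
        rw [← integral_const_mul]
        refine integral_congr_ae (Eventually.of_forall fun x => ?_)
        simp only [halfHartley_eq, mul_assoc, ← integral_mul_const]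
        congr 2
        ext t
        ring
    _ = (√(2 / Real.pi) : ℂ) * ∫ t, ∫ x, (cas x t : ℂ) * (g x * f t) ∂halfLine ∂halfLine := by
        rw [integral_integral_swap hi]
    _ = _ := by
        rw [← integral_const_mul]
        refine integral_congr_ae (Eventually.of_forall fun t => ?_)
        simp only [halfHartley_eq]
        rw [mul_left_comm]
        congr 1
        rw [← integral_const_mul]
        refine integral_congr_ae (Eventually.of_forall fun x => ?_)
        simp only [cas_comm x t]
        ring

theorem halfHartley_conj (f : ℝ → ℂ) (x : ℝ) :
    halfHartley (fun t => starRingEnd ℂ (f t)) x = starRingEnd ℂ (halfHartley f x) := by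
  simp only [halfHartley_eq, map_mul, Complex.conj_ofReal, ← integral_conj]

theorem halfHartley_add {f g : ℝ → ℂ} (hf : Integrable f halfLine) (hg : Integrable g halfLine) :
    halfHartley (f + g) = halfHartley f + halfHartley g := by
  ext x
  simp only [halfHartley_eq, Pi.add_apply, mul_add]
  rw [integral_add (integrable_cas_mul hf x) (integrable_cas_mul hg x), mul_add]

theorem halfHartley_smul (c : ℂ) (f : ℝ → ℂ) : halfHartley (c • f) = c • halfHartley f := by
  ext x
  simp only [halfHartley_eq, Pi.smul_apply, smul_eq_mul, mul_left_comm _ c]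
  rw [integral_const_mul, mul_left_comm]

namespace IsTestFunction

variable {f : ℝ → ℂ}

theorem apply_eq_zero (hf : IsTestFunction f) {t : ℝ} (ht : t ∉ Ioi (0 : ℝ)) : f t = 0 :=
  image_eq_zero_of_notMem_tsupport fun h => ht (hf.tsupport_subset h)

theorem integrable_volume (hf : IsTestFunction f) : Integrable f :=
  hf.contDiff.continuous.integrable_of_hasCompactSupport hf.hasCompactSupport

theorem integrable (hf : IsTestFunction f) : Integrable f halfLine := hf.integrable_volume.restrict

theorem memLp (hf : IsTestFunction f) : MemLp f 2 halfLine :=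
  (hf.contDiff.continuous.memLp_of_hasCompactSupport hf.hasCompactSupport).restrict _

theorem setIntegral_mul (hf : IsTestFunction f) (g : ℝ → ℂ) :
    ∫ t, g t * f t ∂halfLine = ∫ t, g t * f t :=
  setIntegral_eq_integral_of_forall_compl_eq_zero fun t ht => by rw [hf.apply_eq_zero ht, mul_zero]

theorem conj (hf : IsTestFunction f) : IsTestFunction fun t => starRingEnd ℂ (f t) where
  contDiff := Complex.conjCLE.contDiff.comp hf.contDiff
  hasCompactSupport := hf.hasCompactSupport.comp_left (map_zero _)
  tsupport_subset := (closure_mono fun t ht => by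
    simpa using ht).trans hf.tsupport_subset

/-- Two integrations by parts, without boundary terms because of the compact support. This is the
source of the decay `x⁻²` of the transform. -/
theorem sq_mul_integral_cas (hf : IsTestFunction f) (x : ℝ) :
    (x : ℂ) ^ 2 * ∫ t, (cas x t : ℂ) * f t = -∫ t, (cas x t : ℂ) * deriv (deriv f) t := by
  have hf1 : ContDiff ℝ 1 (deriv f) := by
    have := hf.contDiff
    rw [show (2 : WithTop ℕ∞) = 1 + 1 by norm_num, contDiff_succ_iff_deriv] at this
    exact this.2.2
  have hc0 := hf.contDiff.continuous
  have hc1 := hf1.continuous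
  have hc2 : Continuous (deriv (deriv f)) := hf1.continuous_deriv le_rfl
  have hs0 := hf.hasCompactSupport
  have hs1 : HasCompactSupport (deriv f) := hs0.deriv
  have hs2 : HasCompactSupport (deriv (deriv f)) := hs1.deriv
  have d0 : ∀ t, HasDerivAt f (deriv f t) t := fun t =>
    (hf.contDiff.differentiable (by norm_num) t).hasDerivAt
  have d1 : ∀ t, HasDerivAt (deriv f) (deriv (deriv f) t) t := fun t =>
    (hf1.differentiable (by norm_num) t).hasDerivAt
  -- The companion of `c`: `c' = x s` and `s' = -x c`.
  let s : ℝ → ℂ := fun t => ((Real.cos (x * t) - Real.sin (x * t) : ℝ) : ℂ)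
  let c : ℝ → ℂ := fun t => (cas x t : ℂ)
  have hlin : ∀ t : ℝ, HasDerivAt (fun t : ℝ => x * t) x t := fun t => by
    simpa using (hasDerivAt_id t).const_mul x
  have dc : ∀ t, HasDerivAt c (x * s t) t := fun t => by
    have := ((hlin t).cos.add (hlin t).sin).ofReal_comp
    refine this.congr_deriv ?_
    simp only [s]
    push_cast
    ring
  have ds : ∀ t, HasDerivAt s (-x * c t) t := fun t => by
    have := ((hlin t).cos.sub (hlin t).sin).ofReal_comp
    refine this.congr_deriv ?_
    simp only [c, cas]
    push_cast
    ring
  have hcc : Continuous c := continuous_iff_continuousAt.2 fun t => (dc t).continuousAt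
  have hcs : Continuous s := continuous_iff_continuousAt.2 fun t => (ds t).continuousAt
  have int : ∀ {u v : ℝ → ℂ}, Continuous u → Continuous v → HasCompactSupport v →
      Integrable (u * v) := fun hu hv hsv =>
    (hu.mul hv).integrable_of_hasCompactSupport hsv.mul_left
  have p1 := integral_mul_deriv_eq_deriv_mul_of_integrable (fun t _ => dc t) (fun t _ => d1 t) (int hcc hc2 hs2)
    (int (continuous_const.mul hcs) hc1 hs1) (int hcc hc1 hs1)
  have p0 := integral_mul_deriv_eq_deriv_mul_of_integrable (fun t _ => ds t) (fun t _ => d0 t) (int hcs hc1 hs1)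
    (int (continuous_const.mul hcc) hc0 hs0) (int hcs hc0 hs0)
  simp only [mul_assoc, integral_const_mul] at p0 p1
  rw [p1, p0]
  simp only [c]
  ring

/-- The half-Hartley transform of a test function is absolutely integrable. -/
theorem integrable_halfHartley (hf : IsTestFunction f) : Integrable (halfHartley f) halfLine := by
  have hd2 : Integrable (deriv (deriv f)) := by
    have hf1 : ContDiff ℝ 1 (deriv f) := by
      have := hf.contDiff
      rw [show (2 : WithTop ℕ∞) = 1 + 1 by norm_num, contDiff_succ_iff_deriv] at this
      exact this.2.2
    exact (hf1.continuous_deriv le_rfl).integrable_of_hasCompactSupport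
      hf.hasCompactSupport.deriv.deriv
  -- The first summand bounds the integral itself and the second bounds `x²` times it; together they
  -- give the integrable majorant `M / (1 + x²)`.
  set M : ℝ := 2 * (∫ t, ‖f t‖) + 2 * ∫ t, ‖deriv (deriv f) t‖ with hM
  have hbound : ∀ x : ℝ, ‖∫ t, (cas x t : ℂ) * f t‖ ≤ M * (1 + x ^ 2)⁻¹ := fun x => by
    rw [← div_eq_mul_inv, le_div_iff₀ (by positivity)]
    have h1 := norm_integral_cas_le hf.integrable_volume x
    have h2 := norm_integral_cas_le hd2 x
    rw [← norm_neg, ← hf.sq_mul_integral_cas x, norm_mul, norm_pow, Complex.norm_real,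
      Real.norm_eq_abs, sq_abs] at h2
    rw [hM]
    linarith
  refine Integrable.mono' (((integrable_inv_one_add_sq.const_mul M).const_mul
    √(2 / Real.pi)).restrict) (aestronglyMeasurable_halfHartley hf.integrable.1)
    (Eventually.of_forall fun x => ?_)
  rw [halfHartley_eq, hf.setIntegral_mul, norm_mul, Complex.norm_real, Real.norm_of_nonneg
    (Real.sqrt_nonneg _)]
  exact mul_le_mul_of_nonneg_left (hbound x) (Real.sqrt_nonneg _)

/-- The transform is bounded and integrable, hence square-integrable. -/
theorem memLp_halfHartley (hf : IsTestFunction f) : MemLp (halfHartley f) 2 halfLine := by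
  have hi := hf.integrable_halfHartley
  rw [memLp_two_iff_integrable_sq_norm hi.1]
  refine Integrable.mono' (hi.norm.const_mul (√(2 / Real.pi) * (2 * ∫ t, ‖f t‖ ∂halfLine)))
    (hi.1.norm.pow 2) (Eventually.of_forall fun x => ?_)
  rw [Real.norm_of_nonneg (by positivity), sq]
  refine mul_le_mul_of_nonneg_right ?_ (norm_nonneg _)
  rw [halfHartley_eq, norm_mul, Complex.norm_real, Real.norm_of_nonneg (Real.sqrt_nonneg _)]
  exact mul_le_mul_of_nonneg_left (norm_integral_cas_le hf.integrable x) (Real.sqrt_nonneg _)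

end IsTestFunction

/-! ### Abel summation of the iterated transform -/

theorem integral_exp_neg_mul_cos_sin {ε : ℝ} (hε : 0 < ε) (a : ℝ) :
    IntegrableOn (fun y : ℝ => Real.exp (-ε * y) * Real.cos (a * y)) (Ioi 0) ∧
    IntegrableOn (fun y : ℝ => Real.exp (-ε * y) * Real.sin (a * y)) (Ioi 0) ∧
    ∫ y in Ioi (0 : ℝ), Real.exp (-ε * y) * Real.cos (a * y) = ε / (ε ^ 2 + a ^ 2) ∧
    ∫ y in Ioi (0 : ℝ), Real.exp (-ε * y) * Real.sin (a * y) = a / (ε ^ 2 + a ^ 2) := by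
  set z : ℂ := ⟨-ε, a⟩ with hz
  have hre : z.re < 0 := by simp [hz, hε]
  have hi := integrableOn_exp_mul_complex_Ioi hre 0
  have hI := integral_exp_mul_complex_Ioi hre 0
  have e1 : ∀ y : ℝ, (Complex.exp (z * y)).re = Real.exp (-ε * y) * Real.cos (a * y) := fun y => by
    simp [Complex.exp_re, hz]
  have e2 : ∀ y : ℝ, (Complex.exp (z * y)).im = Real.exp (-ε * y) * Real.sin (a * y) := fun y => by
    simp [Complex.exp_im, hz]
  have i1 := hi.re
  have i2 := hi.im
  have r1 := integral_re hi
  have r2 := integral_im hi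
  rw [hI] at r1 r2
  simp only [RCLike.re_to_complex, RCLike.im_to_complex, e1, e2] at i1 i2 r1 r2
  refine ⟨i1, i2, r1.trans ?_, r2.trans ?_⟩
  · simp [Complex.div_re, Complex.normSq_apply, hz]
    ring
  · simp [Complex.div_im, Complex.normSq_apply, hz]
    ring

theorem integral_exp_mul_cas_mul_cas {ε : ℝ} (hε : 0 < ε) (x t : ℝ) :
    ∫ y in Ioi (0 : ℝ), cas t y * (Real.exp (-ε * y) * cas x y) =
      ε / (ε ^ 2 + (x - t) ^ 2) + (x + t) / (ε ^ 2 + (x + t) ^ 2) := by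
  have h1 := integral_exp_neg_mul_cos_sin hε (x - t)
  have h2 := integral_exp_neg_mul_cos_sin hε (x + t)
  rw [← h1.2.2.1, ← h2.2.2.2, ← integral_add h1.1 h2.2.1]
  refine integral_congr_ae (Eventually.of_forall fun y => ?_)
  simp only [cas, sub_mul, add_mul, Real.cos_sub, Real.sin_add]
  ring

theorem integrable_exp_mul_cas {ε : ℝ} (hε : 0 < ε) (x : ℝ) :
    Integrable (fun y : ℝ => ((Real.exp (-ε * y) * cas x y : ℝ) : ℂ)) halfLine := by
  have h1 := integral_exp_neg_mul_cos_sin hε x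
  refine ((h1.1.add h1.2.1).ofReal (𝕜 := ℂ)).congr (Eventually.of_forall fun y => ?_)
  simp [cas, mul_add]

theorem halfHartley_exp_mul_cas {ε : ℝ} (hε : 0 < ε) (x t : ℝ) :
    halfHartley (fun y => ((Real.exp (-ε * y) * cas x y : ℝ) : ℂ)) t =
      (√(2 / Real.pi) : ℂ) *
        ((ε / (ε ^ 2 + (x - t) ^ 2) + (x + t) / (ε ^ 2 + (x + t) ^ 2) : ℝ) : ℂ) := by
  rw [halfHartley_eq, ← integral_exp_mul_cas_mul_cas hε, ← integral_complex_ofReal]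
  simp only [Complex.ofReal_mul]

namespace IsTestFunction

variable {f : ℝ → ℂ}

/-- The Poisson kernel is an approximate identity. -/
theorem tendsto_integral_poisson (hf : IsTestFunction f) (x : ℝ) :
    Tendsto (fun ε : ℝ => ∫ t, ((ε / (ε ^ 2 + (x - t) ^ 2) : ℝ) : ℂ) * f t ∂halfLine)
      (𝓝[>] 0) (𝓝 (Real.pi * f x)) := by
  obtain ⟨M, hM⟩ := hf.hasCompactSupport.exists_bound_of_continuous hf.contDiff.continuous
  have hcont := hf.contDiff.continuous
  -- The substitution `t = x + ε u` moves `ε` into the argument of `f`, leaving a majorant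
  -- independent of `ε`.
  have hlim : Tendsto (fun ε : ℝ => ∫ u : ℝ, (((1 + u ^ 2)⁻¹ : ℝ) : ℂ) * f (x + ε * u))
      (𝓝[>] 0) (𝓝 (∫ u : ℝ, (((1 + u ^ 2)⁻¹ : ℝ) : ℂ) * f x)) := by
    refine tendsto_integral_filter_of_dominated_convergence (fun u => (1 + u ^ 2)⁻¹ * M)
      (Eventually.of_forall fun ε => Continuous.aestronglyMeasurable ?_)
      (Eventually.of_forall fun ε => Eventually.of_forall fun u => ?_)
      (integrable_inv_one_add_sq.mul_const M) (Eventually.of_forall fun u => ?_)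
    · refine (Complex.continuous_ofReal.comp (Continuous.inv₀ (by fun_prop)
        fun u => by positivity)).mul (hcont.comp (by fun_prop))
    · rw [norm_mul, Complex.norm_real, Real.norm_of_nonneg (by positivity)]
      exact mul_le_mul_of_nonneg_left (hM _) (by positivity)
    · refine Tendsto.const_mul _ ?_
      have : Tendsto (fun ε : ℝ => f (x + ε * u)) (𝓝 0) (𝓝 (f (x + 0 * u))) :=
        (hcont.comp (by fun_prop : Continuous fun ε : ℝ => x + ε * u)).tendsto 0
      rw [zero_mul, add_zero] at this
      exact this.mono_left nhdsWithin_le_nhds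
  rw [integral_mul_const, integral_complex_ofReal, integral_univ_inv_one_add_sq] at hlim
  refine hlim.congr' ?_
  filter_upwards [self_mem_nhdsWithin] with ε hε
  have hε : 0 < ε := hε
  rw [hf.setIntegral_mul fun t => ((ε / (ε ^ 2 + (x - t) ^ 2) : ℝ) : ℂ),
    ← integral_add_left_eq_self (fun t => ((ε / (ε ^ 2 + (x - t) ^ 2) : ℝ) : ℂ) * f t) x]
  have := Measure.integral_comp_mul_left
    (fun t => ((ε / (ε ^ 2 + (x - (x + t)) ^ 2) : ℝ) : ℂ) * f (x + t)) ε
  rw [abs_of_pos (inv_pos.2 hε)] at this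
  rw [← smul_inv_smul₀ hε.ne' (∫ t : ℝ, ((ε / (ε ^ 2 + (x - (x + t)) ^ 2) : ℝ) : ℂ) * f (x + t)),
    ← this, ← integral_smul]
  refine integral_congr_ae (Eventually.of_forall fun u => ?_)
  simp only
  rw [Complex.real_smul, ← mul_assoc, ← Complex.ofReal_mul]
  congr 2
  field_simp
  ring

theorem tendsto_integral_stieltjes (hf : IsTestFunction f) {x : ℝ} (hx : 0 < x) :
    Tendsto (fun ε : ℝ => ∫ t, (((x + t) / (ε ^ 2 + (x + t) ^ 2) : ℝ) : ℂ) * f t ∂halfLine)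
      (𝓝[>] 0) (𝓝 (∫ t, ((1 / (x + t) : ℝ) : ℂ) * f t ∂halfLine)) := by
  refine tendsto_integral_filter_of_dominated_convergence (fun t => x⁻¹ * ‖f t‖)
    (Eventually.of_forall fun ε => ?_)
    (Eventually.of_forall fun ε => ae_halfLine_pos.mono fun t ht => ?_)
    (hf.integrable.norm.const_mul _) (ae_halfLine_pos.mono fun t ht => ?_)
  · refine AEStronglyMeasurable.mul (Measurable.aestronglyMeasurable ?_) hf.integrable.1
    fun_prop
  · rw [norm_mul, Complex.norm_real, Real.norm_of_nonneg (by positivity)]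
    refine mul_le_mul_of_nonneg_right ?_ (norm_nonneg _)
    rw [inv_eq_one_div, div_le_div_iff₀ (by positivity) hx]
    nlinarith [sq_nonneg ε, mul_pos hx ht]
  · refine Tendsto.mul_const _ ((Complex.continuous_ofReal.tendsto _).comp ?_)
    have : Tendsto (fun ε : ℝ => (x + t) / (ε ^ 2 + (x + t) ^ 2)) (𝓝 0)
        (𝓝 ((x + t) / (0 ^ 2 + (x + t) ^ 2))) :=
      tendsto_const_nhds.div (((continuous_pow 2).tendsto 0).add_const _) (by positivity)
    rw [show (x + t) / (0 ^ 2 + (x + t) ^ 2) = 1 / (x + t) by field_simp; ring] at this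
    exact this.mono_left nhdsWithin_le_nhds

/-- The iterated half-Hartley transform of a test function. -/
theorem halfHartley_halfHartley (hf : IsTestFunction f) {x : ℝ} (hx : 0 < x) :
    halfHartley (halfHartley f) x =
      2 * f x + (2 / Real.pi : ℂ) * ∫ t, ((1 / (x + t) : ℝ) : ℂ) * f t ∂halfLine := by
  have hG := hf.integrable_halfHartley
  have hc2 : (√(2 / Real.pi) : ℂ) * (√(2 / Real.pi) : ℂ) = 2 / Real.pi := by
    rw [← Complex.ofReal_mul, Real.mul_self_sqrt (by positivity)]
    push_cast
    rfl
  -- The damping factor makes `cas x` integrable, as the Fubini symmetry requires. It can be removed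
  -- in the limit because the transform of `f` is integrable.
  have abel : Tendsto (fun ε : ℝ => (√(2 / Real.pi) : ℂ) *
      ∫ y, halfHartley f y * ((Real.exp (-ε * y) * cas x y : ℝ) : ℂ) ∂halfLine)
      (𝓝[>] 0) (𝓝 (halfHartley (halfHartley f) x)) := by
    rw [halfHartley_eq (halfHartley f)]
    refine Tendsto.const_mul _ (tendsto_integral_filter_of_dominated_convergence
      (fun y => ‖halfHartley f y‖ * 2) (Eventually.of_forall fun ε => ?_) ?_
      (hG.norm.mul_const 2) (Eventually.of_forall fun y => ?_))
    · refine hG.1.mul (Continuous.aestronglyMeasurable (Complex.continuous_ofReal.comp ?_))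
      exact (by fun_prop : Continuous fun y : ℝ => Real.exp (-ε * y)).mul
        (continuous_cas.comp (Continuous.prodMk_right x))
    · filter_upwards [self_mem_nhdsWithin] with ε hε
      have hε : 0 < ε := hε
      filter_upwards [ae_halfLine_pos] with y hy
      rw [norm_mul, Complex.norm_real, Real.norm_eq_abs, abs_mul, Real.abs_exp]
      refine mul_le_mul_of_nonneg_left ?_ (norm_nonneg _)
      have he : Real.exp (-ε * y) ≤ 1 := Real.exp_le_one_iff.2 (by nlinarith [mul_pos hε hy])
      calc _ ≤ 1 * |cas x y| := mul_le_mul_of_nonneg_right he (abs_nonneg _)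
        _ ≤ 2 := by rw [one_mul]; exact abs_cas_le x y
    · rw [mul_comm (cas x y : ℂ)]
      refine Tendsto.const_mul _ ((Complex.continuous_ofReal.tendsto _).comp ?_)
      have : Tendsto (fun ε : ℝ => Real.exp (-ε * y) * cas x y) (𝓝 0)
          (𝓝 (Real.exp (-0 * y) * cas x y)) :=
        (by fun_prop : Continuous fun ε : ℝ => Real.exp (-ε * y) * cas x y).tendsto 0
      rw [neg_zero, zero_mul, Real.exp_zero, one_mul] at this
      exact this.mono_left nhdsWithin_le_nhds
  have lim := ((hf.tendsto_integral_poisson x).add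
    (hf.tendsto_integral_stieltjes hx)).const_mul (2 / Real.pi : ℂ)
  have hpi : (Real.pi : ℂ) ≠ 0 := Complex.ofReal_ne_zero.2 Real.pi_ne_zero
  rw [mul_add, ← mul_assoc (2 / (Real.pi : ℂ)) (Real.pi : ℂ), div_mul_cancel₀ _ hpi] at lim
  refine tendsto_nhds_unique abel (lim.congr' ?_)
  filter_upwards [self_mem_nhdsWithin] with ε hε
  have hε : 0 < ε := hε
  have bdd : ∀ k : ℝ → ℝ, Measurable k → ∀ B, (∀ t, |k t| ≤ B) →
      Integrable (fun t => (k t : ℂ) * f t) halfLine := fun k hk B hB =>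
    hf.integrable.bdd_mul (Complex.measurable_ofReal.comp hk).aestronglyMeasurable
      (c := B) (Eventually.of_forall fun t => by rw [Complex.norm_real]; exact hB t)
  have i1 := bdd (fun t => ε / (ε ^ 2 + (x - t) ^ 2)) (by fun_prop) ε⁻¹ fun t => by
    rw [abs_of_nonneg (by positivity), inv_eq_one_div, div_le_div_iff₀ (by positivity) hε]
    nlinarith [sq_nonneg (x - t)]
  have i2 := bdd (fun t => (x + t) / (ε ^ 2 + (x + t) ^ 2)) (by fun_prop) ε⁻¹ fun t => by
    rw [abs_div, abs_of_nonneg (by positivity : 0 ≤ ε ^ 2 + (x + t) ^ 2), inv_eq_one_div,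
      div_le_div_iff₀ (by positivity) hε, ← sq_abs (x + t)]
    nlinarith [sq_nonneg (|x + t| - ε), abs_nonneg (x + t), sq_nonneg (|x + t|)]
  -- Symmetry moves the transform from `f` onto the damped kernel, where it is explicit.
  rw [integral_halfHartley_mul hf.integrable (integrable_exp_mul_cas hε x), ← integral_add i1 i2,
    ← hc2, mul_assoc]
  congr 1
  rw [← integral_const_mul]
  refine integral_congr_ae (Eventually.of_forall fun t => ?_)
  simp only [halfHartley_exp_mul_cas hε, Complex.ofReal_add]
  ring

end IsTestFunction

/-! ### Density and the bounded extension of the transform -/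

/-- The space of test functions. -/
def testSpace : Submodule ℂ (ℝ → ℂ) where
  carrier := {f | IsTestFunction f}
  add_mem' {f g} hf hg :=
    ⟨hf.contDiff.add hg.contDiff, hf.hasCompactSupport.add hg.hasCompactSupport,
      (tsupport_add f g).trans (union_subset hf.tsupport_subset hg.tsupport_subset)⟩
  zero_mem' := ⟨contDiff_const, HasCompactSupport.zero, by
    rw [tsupport, Function.support_zero, closure_empty]
    exact empty_subset _⟩
  smul_mem' c f hf :=
    ⟨contDiff_const.smul hf.contDiff, hf.hasCompactSupport.smul_left,
      (tsupport_smul_subset_right (fun _ => c) f).trans hf.tsupport_subset⟩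

/-- The inclusion of the test functions in `L₂(ℝ₊)`. -/
noncomputable def testIncl : testSpace →ₗ[ℂ] L2HalfLine where
  toFun f := (IsTestFunction.memLp f.2).toLp f
  map_add' _ _ := rfl
  map_smul' _ _ := rfl

/-- The half-Hartley transform on test functions. -/
noncomputable def testHartley : testSpace →ₗ[ℂ] L2HalfLine where
  toFun f := (IsTestFunction.memLp_halfHartley f.2).toLp _
  map_add' f g := by
    rw [← MemLp.toLp_add, MemLp.toLp_eq_toLp_iff]
    exact Eventually.of_forall (congrFun (halfHartley_add (IsTestFunction.integrable f.2)
      (IsTestFunction.integrable g.2)))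
  map_smul' c f := by
    rw [← MemLp.toLp_const_smul, MemLp.toLp_eq_toLp_iff]
    exact Eventually.of_forall (congrFun (halfHartley_smul c f))

theorem testIncl_apply (f : testSpace) : testIncl f =ᵐ[halfLine] (f : ℝ → ℂ) :=
  MemLp.coeFn_toLp (IsTestFunction.memLp f.2)

theorem testHartley_apply (f : testSpace) : testHartley f =ᵐ[halfLine] halfHartley f :=
  MemLp.coeFn_toLp (IsTestFunction.memLp_halfHartley f.2)

/-- An element orthogonal to all test functions integrates to zero against every real smooth bump
supported in `(0, ∞)`, so it vanishes almost everywhere. -/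
theorem denseRange_testIncl : DenseRange testIncl := by
  have h : Dense (LinearMap.range testIncl : Set L2HalfLine) := by
    rw [Submodule.dense_iff_topologicalClosure_eq_top, Submodule.topologicalClosure_eq_top_iff,
      Submodule.eq_bot_iff]
    intro g hg
    rw [Submodule.mem_orthogonal] at hg
    have hloc : LocallyIntegrable g halfLine := (Lp.memLp g).locallyIntegrable one_le_two
    have key := isOpen_Ioi.ae_eq_zero_of_integral_contDiff_smul_eq_zero
      (U := Ioi (0 : ℝ)) (hloc.locallyIntegrableOn _) fun φ hφ hsupp hsub => by
        have hφt : IsTestFunction fun t => (φ t : ℂ) :=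
          ⟨Complex.ofRealCLM.contDiff.comp (contDiff_infty.1 hφ 2),
            hsupp.comp_left Complex.ofReal_zero, (closure_mono fun t ht => by
              simpa using ht).trans hsub⟩
        rw [← hg _ ⟨⟨_, hφt⟩, rfl⟩, L2.inner_def]
        refine integral_congr_ae ?_
        filter_upwards [testIncl_apply ⟨_, hφt⟩] with t ht
        rw [ht]
        simp [mul_comm]
    refine (Lp.eq_zero_iff_ae_eq_zero).2 ?_
    filter_upwards [key, ae_halfLine_pos] with t h1 h2
    exact h1 h2
  rwa [LinearMap.coe_range] at h

theorem stieltjesOp_apply (f : L2HalfLine) :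
    stieltjesOp f =ᵐ[halfLine] fun x => ∫ t, ((1 / (x + t) : ℝ) : ℂ) * f t ∂halfLine :=
  schurKernel_stieltjes.op_apply f

theorem hartleySqOp_ae (f : L2HalfLine) :
    hartleySqOp f =ᵐ[halfLine] fun x =>
      2 * f x + (2 / Real.pi : ℂ) * ∫ t, ((1 / (x + t) : ℝ) : ℂ) * f t ∂halfLine := by
  rw [hartleySqOp_apply]
  filter_upwards [Lp.coeFn_add ((2 : ℂ) • f) ((2 / Real.pi : ℂ) • stieltjesOp f),
    Lp.coeFn_smul (2 : ℂ) f, Lp.coeFn_smul (2 / Real.pi : ℂ) (stieltjesOp f),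
    stieltjesOp_apply f] with x h1 h2 h3 h4
  rw [h1, Pi.add_apply, h2, h3, Pi.smul_apply, Pi.smul_apply, h4, smul_eq_mul, smul_eq_mul]

theorem hartleySqOp_testIncl (f : testSpace) :
    hartleySqOp (testIncl f) =ᵐ[halfLine] halfHartley (halfHartley f) := by
  filter_upwards [hartleySqOp_ae (testIncl f), testIncl_apply f, ae_halfLine_pos] with x h1 h2 hx
  rw [h1, h2, IsTestFunction.halfHartley_halfHartley f.2 hx]
  congr 2
  refine integral_congr_ae ?_
  filter_upwards [testIncl_apply f] with t ht
  rw [ht]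

/-- The kernel is real, so the transform commutes with conjugation, and the bilinear Fubini symmetry
becomes a Hermitian one. -/
theorem inner_testHartley_testIncl (f g : testSpace) :
    ⟪testHartley f, testIncl g⟫_ℂ = ⟪testIncl f, testHartley g⟫_ℂ := by
  have hf : IsTestFunction f.1 := f.2
  have hg : IsTestFunction g.1 := g.2
  rw [L2.inner_def, L2.inner_def]
  calc _ = ∫ x, halfHartley (fun t => starRingEnd ℂ (f.1 t)) x * g.1 x ∂halfLine := by
        refine integral_congr_ae ?_
        filter_upwards [testHartley_apply f, testIncl_apply g] with x h1 h2
        rw [h1, h2, halfHartley_conj, RCLike.inner_apply, mul_comm]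
    _ = ∫ x, starRingEnd ℂ (f.1 x) * halfHartley g.1 x ∂halfLine :=
        integral_halfHartley_mul hf.conj.integrable hg.integrable
    _ = _ := by
        refine integral_congr_ae ?_
        filter_upwards [testIncl_apply f, testHartley_apply g] with x h1 h2
        rw [h1, h2, RCLike.inner_apply, mul_comm]

theorem inner_testHartley_testHartley (f g : testSpace) :
    ⟪testHartley f, testHartley g⟫_ℂ = ⟪testIncl f, hartleySqOp (testIncl g)⟫_ℂ := by
  have hf : IsTestFunction f.1 := f.2
  have hg : IsTestFunction g.1 := g.2
  rw [L2.inner_def, L2.inner_def]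
  calc _ = ∫ x, halfHartley (fun t => starRingEnd ℂ (f.1 t)) x * halfHartley g.1 x ∂halfLine := by
        refine integral_congr_ae ?_
        filter_upwards [testHartley_apply f, testHartley_apply g] with x h1 h2
        rw [h1, h2, halfHartley_conj, RCLike.inner_apply, mul_comm]
    _ = ∫ x, starRingEnd ℂ (f.1 x) * halfHartley (halfHartley g.1) x ∂halfLine :=
        integral_halfHartley_mul hf.conj.integrable hg.integrable_halfHartley
    _ = _ := by
        refine integral_congr_ae ?_
        filter_upwards [testIncl_apply f, hartleySqOp_testIncl g] with x h1 h2
        rw [h1, h2, RCLike.inner_apply, mul_comm]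

/-- From `‖H f‖² = ⟪f, T f⟫ ≤ ‖f‖ · 4 ‖f‖`, where the bound on `T` comes from the Stieltjes
operator. -/
theorem norm_testHartley_le (f : testSpace) : ‖testHartley f‖ ≤ 2 * ‖testIncl f‖ := by
  refine le_of_sq_le_sq ?_ (by positivity)
  rw [← inner_self_eq_norm_sq (𝕜 := ℂ), inner_testHartley_testHartley]
  calc _ ≤ ‖testIncl f‖ * ‖hartleySqOp (testIncl f)‖ := re_inner_le_norm _ _
    _ ≤ ‖testIncl f‖ * (4 * ‖testIncl f‖) := by
        gcongr
        exact norm_hartleySqOp_le _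
    _ = _ := by ring

/-- The bounded extension of the half-Hartley transform to `L₂(ℝ₊)`. -/
noncomputable def hartleyOp : L2HalfLine →L[ℂ] L2HalfLine := testHartley.extendOfNorm testIncl

theorem hartleyOp_testIncl (f : testSpace) : hartleyOp (testIncl f) = testHartley f :=
  LinearMap.extendOfNorm_eq denseRange_testIncl ⟨2, norm_testHartley_le⟩ f

theorem inner_hartleyOp_left (u v : L2HalfLine) :
    ⟪hartleyOp u, v⟫_ℂ = ⟪u, hartleyOp v⟫_ℂ := by
  refine denseRange_testIncl.induction_on₂ (p := fun u v => ⟪hartleyOp u, v⟫_ℂ = ⟪u, hartleyOp v⟫_ℂ)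
    (isClosed_eq (by fun_prop) (by fun_prop)) (fun f g => ?_) u v
  rw [hartleyOp_testIncl, hartleyOp_testIncl, inner_testHartley_testIncl]

theorem inner_hartleyOp_hartleyOp (u v : L2HalfLine) :
    ⟪hartleyOp u, hartleyOp v⟫_ℂ = ⟪u, hartleySqOp v⟫_ℂ := by
  refine denseRange_testIncl.induction_on₂
    (p := fun u v => ⟪hartleyOp u, hartleyOp v⟫_ℂ = ⟪u, hartleySqOp v⟫_ℂ)
    (isClosed_eq (by fun_prop) (by fun_prop)) (fun f g => ?_) u v
  rw [hartleyOp_testIncl, hartleyOp_testIncl, inner_testHartley_testHartley]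

/-- The transform of a test function need not be a test function, so `H²` cannot be read off from
the dense subspace. Instead `⟪u, H² v⟫ = ⟪H u, H v⟫ = ⟪u, T v⟫` for all `u`. -/
theorem hartleySqOp_eq_comp : hartleySqOp = hartleyOp.comp hartleyOp := by
  ext1 v
  refine ext_inner_left ℂ fun u => ?_
  rw [ContinuousLinearMap.comp_apply, ← inner_hartleyOp_left, inner_hartleyOp_hartleyOp]

/-! ### Uniqueness of extensions and the main theorem -/

theorem extendsTransform_iff {K : (ℝ → ℂ) → ℝ → ℂ} {T : L2HalfLine →L[ℂ] L2HalfLine} :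
    ExtendsTransform K T ↔ ∀ f : testSpace, T (testIncl f) =ᵐ[halfLine] K f :=
  ⟨fun h f => (h f.1 f.2).2, fun h f hf => ⟨hf.memLp, h ⟨f, hf⟩⟩⟩

theorem ExtendsTransform.unique {K : (ℝ → ℂ) → ℝ → ℂ} {T T' : L2HalfLine →L[ℂ] L2HalfLine}
    (h : ExtendsTransform K T) (h' : ExtendsTransform K T') : T' = T := by
  rw [extendsTransform_iff] at h h'
  exact DFunLike.coe_injective (denseRange_testIncl.equalizer T'.continuous T.continuous
    (funext fun f => Lp.ext ((h' f).trans (h f).symm)))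

theorem ofReal_one_div_mul (x t : ℝ) (z : ℂ) :
    ((1 / (x + t) : ℝ) : ℂ) * z = z / ((x + t : ℝ) : ℂ) := by
  rw [Complex.ofReal_div, Complex.ofReal_one, one_div_mul_eq_div]

theorem hartleySqInvOp_ae (g : L2HalfLine) :
    hartleySqInvOp g =ᵐ[halfLine] fun x => (1 / 2 : ℂ) * g x - (1 / (Real.pi : ℂ) ^ 2) *
      ∫ t in Ioi (0 : ℝ), (logKernel x t : ℂ) * g t := by
  rw [hartleySqInvOp_apply]
  filter_upwards [Lp.coeFn_sub ((1 / 2 : ℂ) • g) ((1 / (Real.pi : ℂ) ^ 2) • cauchyOp (cauchyOp g)),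
    Lp.coeFn_smul (1 / 2 : ℂ) g, Lp.coeFn_smul (1 / (Real.pi : ℂ) ^ 2) (cauchyOp (cauchyOp g)),
    cauchyOp_cauchyOp_apply g] with x h1 h2 h3 h4
  rw [h1, Pi.sub_apply, h2, h3, Pi.smul_apply, Pi.smul_apply, h4, smul_eq_mul, smul_eq_mul]

theorem theorem2 :
    -- on test functions both integrals in the iterated transform converge absolutely
    (∀ f : ℝ → ℂ, IsTestFunction f →
      IntegrableOn f (Ioi 0) ∧ IntegrableOn (halfHartley f) (Ioi 0)) ∧
    ∃ T : L2HalfLine ≃L[ℂ] L2HalfLine,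
      -- `T` is the unique bounded extension of the iterated transform
      ExtendsTransform (fun f => halfHartley (halfHartley f)) (T : L2HalfLine →L[ℂ] L2HalfLine) ∧
      (∀ T' : L2HalfLine →L[ℂ] L2HalfLine,
        ExtendsTransform (fun f => halfHartley (halfHartley f)) T' →
          T' = (T : L2HalfLine →L[ℂ] L2HalfLine)) ∧
      -- it is the square of the bounded extension of the transform itself
      (∃ H : L2HalfLine →L[ℂ] L2HalfLine, ExtendsTransform halfHartley H ∧
        (T : L2HalfLine →L[ℂ] L2HalfLine) = H.comp H) ∧
      -- the reciprocal formulas, with absolutely convergent integrals for every `x > 0`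
      (∀ f : L2HalfLine,
        (∀ x : ℝ, 0 < x → IntegrableOn (fun t : ℝ => f t / ((x + t : ℝ) : ℂ)) (Ioi 0)) ∧
        ∀ᵐ x ∂halfLine, T f x =
          2 * f x + (2 / Real.pi : ℂ) * ∫ t in Ioi (0 : ℝ), f t / ((x + t : ℝ) : ℂ)) ∧
      (∀ f : L2HalfLine,
        (∀ x : ℝ, 0 < x → IntegrableOn (fun t : ℝ => (logKernel x t : ℂ) * T f t) (Ioi 0)) ∧
        ∀ᵐ x ∂halfLine, f x =
          (1 / 2 : ℂ) * T f x -
            (1 / (Real.pi : ℂ) ^ 2) * ∫ t in Ioi (0 : ℝ), (logKernel x t : ℂ) * T f t) ∧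
      -- the norm inequalities
      (∀ f : L2HalfLine, ‖f‖ ≤ ‖T f‖ ∧ ‖T f‖ ≤ 8 * ‖f‖) := by
  have hext : ExtendsTransform (fun f => halfHartley (halfHartley f))
      (hartleySqEquiv : L2HalfLine →L[ℂ] L2HalfLine) :=
    extendsTransform_iff.2 hartleySqOp_testIncl
  refine ⟨fun f hf => ⟨hf.integrable, hf.integrable_halfHartley⟩, hartleySqEquiv, hext,
    fun T' hT' => hext.unique hT', ⟨hartleyOp, extendsTransform_iff.2 fun f => ?_,
      hartleySqOp_eq_comp⟩, fun f => ⟨fun x hx => ?_, ?_⟩, fun f => ⟨fun x hx => ?_, ?_⟩,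
    fun f => ⟨?_, ?_⟩⟩
  · rw [hartleyOp_testIncl]
    exact testHartley_apply f
  · simp only [← ofReal_one_div_mul]
    exact schurKernel_stieltjes.integrable_mul (Lp.memLp f) hx
  · simp only [← ofReal_one_div_mul]
    exact hartleySqOp_ae f
  · exact integrableOn_logKernel_mul (Lp.memLp _) hx
  · have h := hartleySqInvOp_ae (hartleySqOp f)
    rw [hartleySqInvOp_hartleySqOp] at h
    exact h
  -- The lower bound is the contractivity of the inverse, applied to `T f`; in the upper bound the
  -- constant `8` is weakened from `4`.
  · have h := norm_hartleySqInvOp_le (hartleySqOp f)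
    rwa [hartleySqInvOp_hartleySqOp] at h
  · exact (norm_hartleySqOp_le f).trans (by gcongr; norm_num)
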